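/- All matroids are finite. For a matroid $M$ with rank function $r_M$, let $\lambda_M(X)=r_M(X)+r_M(E(M)\setminus X)-r_M(E(M))$. A $k$-separation of $M$ is a partition $(X,Y)$ of $E(M)$ with $|X|,|Y|\ge k$ and $\lambda_M(X)<k$; $M$ is 3-connected if it has no $k$-separation with $k<3$. A tangle of $M$ of order $\theta$ is a collection $\mathcal T$ of subsets of $E(M)$ such that (i) $\lambda_M(X)<\theta$ for all $X\in\mathcal T$; (ii) if $X\subseteq E(M)$ and $\lambda_M(X)<\theta$ then $X\in\mathcal T$ or $E(M)\setminus X\in\mathcal T$; (iii) no three members of $\mathcal T$ have union $E(M)$; (iv) $E(M)\setminus\{e\}\notin\mathcal T$ for each $e\in E(M)$. The rank $r_{\mathcal T}(X)$ of $X\subseteq E(M)$ is $\min\{\lambda_M(Y): X\subseteq Y\in\mathcal T\}$ if some member of $\mathcal T$ contains $X$, and $\theta$ otherwise. Let $M$ be a 3-connected matroid and let $C,D\subseteq E(M)$ be disjoint sets such that $M/C\backslash D$ is 3-connected. The restoration graph $R(M,C,D)$ is the bipartite graph with vertex set $C\cup D$ in which $c\in C$ and $d\in D$ are adjacent if and only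 if $M/(C\setminus\{c\})\backslash(D\setminus\{d\})$ is 3-connected. A vertex $e\in C\cup D$ is privileged if $M/(C\setminus\{e\})\backslash(D\setminus\{e\})$ is 3-connected. A matching is a subgraph in which each vertex has degree 1; it is induced if it is an induced subgraph. Let $k$ be an integer, let $\mathcal T$ be a tangle of $M$, let $N$ be a minor of $M/C\backslash D$, let $t:=r_{\mathcal T}(E(N))$, and suppose that $r_{\mathcal T}(E(N)\cup C\cup D)=t+|C\cup D|$. If $R(M,C,D)$ contains an induced matching with at least $2k$ edges and no privileged vertices, then at least one of the following holds: 1. there is a set $C'\subseteq E(M)$ such that $r_{\mathcal T}(E(N)\cup C')=t+|C'|$, $|C'|\ge k$, and $M/C'$ is 3-connected with $N$ as a minor; 2. there is a set $D'\subseteq E(M)$ such that $r_{\mathcal T}(E(N)\cup D')=t+|D'|$, $|D'|\ge k$, and $M\backslash D'$ is 3-connected with $N$ as a minor. -/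

import Mathlib

open scoped Matroid

namespace MatroidTangle

variable {α : Type*}

/-- The rank of a set, as a natural number (used for finite matroids only). -/
noncomputable def rk (M : Matroid α) (X : Set α) : ℕ := (M.eRk X).toNat

/-- The connectivity function `λ_M(X) = r(X) + r(E ∖ X) - r(M)`. The subtraction does not
truncate, by submodularity of the rank. -/
noncomputable def conn (M : Matroid α) (X : Set α) : ℕ :=
  rk M X + rk M (M.E \ X) - rk M M.E

/-- `(X, Y)` is a `k`-separation of `M`. -/
structure IsSeparation (M : Matroid α) (k : ℕ) (X Y : Set α) : Prop where
  union_eq : X ∪ Y = M.E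
  disjoint : Disjoint X Y
  le_left : (k : ℕ∞) ≤ X.encard
  le_right : (k : ℕ∞) ≤ Y.encard
  conn_lt : conn M X < k

/-- `M` is `k`-connected: it has no `k'`-separation with `k' < k`. -/
def IsKConnected (M : Matroid α) (k : ℕ) : Prop :=
  ∀ k' < k, ∀ X Y : Set α, ¬ IsSeparation M k' X Y

/-- `T` is a tangle of `M` of order `θ`. -/
structure IsTangle (M : Matroid α) (T : Set (Set α)) (θ : ℕ) : Prop where
  subset_ground : ∀ X ∈ T, X ⊆ M.E
  conn_lt : ∀ X ∈ T, conn M X < θ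
  mem_or_compl_mem : ∀ X ⊆ M.E, conn M X < θ → X ∈ T ∨ M.E \ X ∈ T
  union_ne : ∀ X ∈ T, ∀ Y ∈ T, ∀ Z ∈ T, X ∪ Y ∪ Z ≠ M.E
  compl_singleton_notMem : ∀ e ∈ M.E, M.E \ {e} ∉ T

open Classical in
/-- The rank function of the tangle matroid of a tangle `T` of order `θ`:
the least `λ_M(Y)` over the members `Y` of `T` containing `X`, and `θ` if there is none. -/
noncomputable def tangleRank (M : Matroid α) (T : Set (Set α)) (θ : ℕ) (X : Set α) : ℕ :=
  if ∃ Y ∈ T, X ⊆ Y then sInf {n | ∃ Y ∈ T, X ⊆ Y ∧ conn M Y = n} else θ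

/-- The matroid obtained from `M ／ C ＼ D` by restoring `Z`. -/
def restore (M : Matroid α) (C D Z : Set α) : Matroid α := M ／ (C \ Z) ＼ (D \ Z)

/-- `e` is privileged: restoring `e` yields a 3-connected matroid. -/
def IsPrivileged (M : Matroid α) (C D : Set α) (e : α) : Prop :=
  IsKConnected (restore M C D {e}) 3

/-- `cd` is an edge of the restoration graph, with `c` in `C` and `d` in `D`. -/
def RestorationEdge (M : Matroid α) (C D : Set α) (c d : α) : Prop :=
  c ∈ C ∧ d ∈ D ∧ IsKConnected (M ／ (C \ {c}) ＼ (D \ {d})) 3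

/-- The restoration graph `R(M, C, D)`, with vertex set `C ∪ D`. -/
def restorationGraph (M : Matroid α) (C D : Set α) (hCD : Disjoint C D) :
    SimpleGraph ↥(C ∪ D) where
  Adj x y := RestorationEdge M C D x y ∨ RestorationEdge M C D y x
  symm := ⟨fun _ _ h => h.symm⟩
  loopless := ⟨fun _ h => by
    rcases h with h | h <;> exact Set.disjoint_left.1 hCD h.1 h.2.1⟩

end MatroidTangle

open Set

namespace MatroidTangle

variable {α : Type*} {M N : Matroid α} {X Y C D : Set α} {e x y : α}

/-! ### Rank -/

/-! Write `Z = C ∪ D`. The rank hypothesis makes `Z` independent in the tangle matroid, even over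
`E(N)`. A circuit or cocircuit of `M` has tangle rank below its size, so `Z` is independent and
coindependent in `M`. The same comparison shows that a matroid between `M` and `M ／ C ＼ D` can fail
to be 3-connected only through a parallel or series pair (`exists_circuitVia_of_not_isKConnected`):
a circuit in `C ∪ {d, x}`, or a cocircuit in `D ∪ {c, x}`, with `x ∉ Z`.

An unprivileged `d` thus has a circuit `J`, unique since `M ／ C ＼ D` is simple, and an unprivileged
`c` has a cocircuit `K`. Orthogonality gives `c ∈ J ↔ d ∈ K` (`mem_circuit_iff_mem_cocircuit`), and
this is adjacency in the restoration graph. An induced matching therefore gives pairs with `d j ∈ K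
i ↔ i = j`.

For `C' ⊆ C`, the matroid `M ／ C'` is 3-connected once no circuit of the above type has its `C`-part
inside `C'`; dually for deletion. Pairs whose `J i` or `K i` meets `C` or `D` in a second element
are distributed directly: a contraction spoiled by an unmatched `u ∈ D` is traded for the deletion
of `u`. For the other pairs `K i` is a triad, the start of a fan. The pair is pushed along the fan
by exchanging parallel or series elements until it reaches an end lying in no triangle, which can be
contracted, or in no triad, which can be deleted (`exists_maximal`, `contract`). The contracted and
deleted sets together have at least as many elements as there are pairs, hence at least `2k`, so one
has at least `k`. -/

lemma coe_rk (M : Matroid α) [M.Finite] (X : Set α) : (rk M X : ℕ∞) = M.eRk X := by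
  rw [rk, ENat.natCast_toNat_eq_self]
  exact ((M.eRk_le_eRank X).trans_lt (Matroid.eRank_lt_top_iff.2 inferInstance)).ne

lemma rk_mono (M : Matroid α) [M.Finite] (h : X ⊆ Y) : rk M X ≤ rk M Y := by
  have := M.eRk_mono h
  rw [← coe_rk, ← coe_rk] at this
  exact_mod_cast this

lemma rk_inter_add_rk_union_le (M : Matroid α) [M.Finite] (X Y : Set α) :
    rk M (X ∩ Y) + rk M (X ∪ Y) ≤ rk M X + rk M Y := by
  have := M.eRk_inter_add_eRk_union_le X Y
  simp only [← coe_rk] at this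
  exact_mod_cast this

lemma rk_le_ncard (M : Matroid α) [M.Finite] (hX : X ⊆ M.E) : rk M X ≤ X.ncard := by
  have := M.eRk_le_encard X
  rw [← coe_rk, ← (M.ground_finite.subset hX).cast_ncard_eq] at this
  exact_mod_cast this

lemma rk_union_le (M : Matroid α) [M.Finite] (X Y : Set α) :
    rk M (X ∪ Y) ≤ rk M X + rk M Y := by
  have := rk_inter_add_rk_union_le M X Y
  omega

lemma rk_dual_add (M : Matroid α) [M.Finite] (hX : X ⊆ M.E) :
    rk M✶ X + rk M M.E = rk M (M.E \ X) + X.ncard := by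
  have := M.eRk_dual_add_eRank X hX
  rw [← M.eRk_ground, ← coe_rk, ← coe_rk, ← coe_rk,
    ← (M.ground_finite.subset hX).cast_ncard_eq] at this
  exact_mod_cast this

lemma rk_delete (M : Matroid α) (hX : Disjoint X D) : rk (M ＼ D) X = rk M X := by
  rw [rk, Matroid.delete_eq_restrict, Matroid.restrict_eRk_eq', rk, ← M.eRk_inter_ground X,
    ← inter_sdiff_assoc, (hX.mono_left inter_subset_left).sdiff_eq_left]

lemma rk_lt_ncard_iff_dep (M : Matroid α) [M.Finite] (hX : X ⊆ M.E) :
    rk M X < X.ncard ↔ M.Dep X := by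
  rw [← Matroid.eRk_lt_encard_iff_dep hX, ← coe_rk,
    ← (M.ground_finite.subset hX).cast_ncard_eq]
  norm_cast

/-! ### Connectivity -/

lemma conn_add (M : Matroid α) [M.Finite] (X : Set α) :
    conn M X + rk M M.E = rk M X + rk M (M.E \ X) := by
  have h := rk_inter_add_rk_union_le M X (M.E \ X)
  have h' := rk_mono M (show M.E ⊆ X ∪ (M.E \ X) by tauto_set)
  rw [conn]
  omega

lemma conn_compl (M : Matroid α) [M.Finite] (hX : X ⊆ M.E) : conn M (M.E \ X) = conn M X := by
  have h1 := conn_add M X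
  have h2 := conn_add M (M.E \ X)
  rw [show M.E \ (M.E \ X) = X by tauto_set] at h2
  omega

lemma conn_add_ncard (M : Matroid α) [M.Finite] (hX : X ⊆ M.E) :
    conn M X + X.ncard = rk M X + rk M✶ X := by
  have h1 := conn_add M X
  have h2 := rk_dual_add M hX
  omega

lemma conn_dual (M : Matroid α) [M.Finite] (hX : X ⊆ M.E) : conn M✶ X = conn M X := by
  have h1 := conn_add_ncard M hX
  have h2 := conn_add_ncard M✶ (X := X) hX
  rw [Matroid.dual_dual] at h2
  omega

lemma conn_inter_add_conn_union_le (M : Matroid α) [M.Finite] (X Y : Set α) :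
    conn M (X ∩ Y) + conn M (X ∪ Y) ≤ conn M X + conn M Y := by
  have h1 := conn_add M X
  have h2 := conn_add M Y
  have h3 := conn_add M (X ∩ Y)
  have h4 := conn_add M (X ∪ Y)
  have h5 := rk_inter_add_rk_union_le M X Y
  have h6 := rk_inter_add_rk_union_le M (M.E \ X) (M.E \ Y)
  rw [show M.E \ X ∩ (M.E \ Y) = M.E \ (X ∪ Y) by tauto_set,
    show M.E \ X ∪ (M.E \ Y) = M.E \ (X ∩ Y) by tauto_set] at h6
  omega

lemma conn_le_ncard (M : Matroid α) [M.Finite] (hX : X ⊆ M.E) : conn M X ≤ X.ncard := by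
  have h1 := conn_add_ncard M hX
  have h2 := rk_le_ncard M hX
  have h3 := rk_le_ncard M✶ (X := X) hX
  omega

lemma conn_delete_le (M : Matroid α) [M.Finite] (D : Set α) (hX : X ⊆ M.E) :
    conn (M ＼ D) (X \ D) ≤ conn M X := by
  have h1 := conn_add M X
  have h2 := conn_add (M ＼ D) (X \ D)
  rw [rk_delete _ disjoint_sdiff_left, Matroid.delete_ground, rk_delete _ disjoint_sdiff_left,
    rk_delete _ (disjoint_sdiff_left.mono_left sdiff_subset)] at h2
  have h3 := rk_inter_add_rk_union_le M X (M.E \ D)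
  have h4 := rk_inter_add_rk_union_le M (M.E \ X) (X ∪ M.E \ D)
  rw [show X ∩ (M.E \ D) = X \ D by tauto_set] at h3
  rw [show M.E \ X ∩ (X ∪ M.E \ D) = (M.E \ D) \ (X \ D) by tauto_set,
    show M.E \ X ∪ (X ∪ M.E \ D) = M.E by tauto_set] at h4
  omega

lemma conn_contract_le (M : Matroid α) [M.Finite] (C : Set α) (hX : X ⊆ M.E) :
    conn (M ／ C) (X \ C) ≤ conn M X := by
  have h := conn_delete_le M✶ C (X := X) hX
  rw [← Matroid.dual_contract, conn_dual M hX,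
    conn_dual (M ／ C) (by simpa using sdiff_subset_sdiff_left hX)] at h
  exact h

lemma conn_union_le_conn_delete_add (M : Matroid α) [M.Finite] (hX : Disjoint X D)
    (hD : D ⊆ M.E) : conn M (X ∪ D) ≤ conn (M ＼ D) X + D.ncard := by
  have h1 := conn_add M (X ∪ D)
  have h2 := conn_add (M ＼ D) X
  rw [rk_delete _ hX, Matroid.delete_ground, rk_delete _ disjoint_sdiff_left,
    rk_delete _ (disjoint_sdiff_left.mono_left sdiff_subset)] at h2
  have h3 := rk_union_le M X D
  have h4 := rk_le_ncard M hD
  have h5 := rk_mono M (show M.E \ D ⊆ M.E from sdiff_subset)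
  rw [show M.E \ (X ∪ D) = (M.E \ D) \ X by tauto_set] at h1
  omega

lemma conn_union_le_conn_contract_add (M : Matroid α) [M.Finite] (hX : X ⊆ M.E)
    (hXC : Disjoint X C) (hC : C ⊆ M.E) : conn M (X ∪ C) ≤ conn (M ／ C) X + C.ncard := by
  have h := conn_union_le_conn_delete_add M✶ hXC (D := C) hC
  rwa [← Matroid.dual_contract, conn_dual M (union_subset hX hC),
    conn_dual (M ／ C) (by simpa using subset_sdiff.2 ⟨hX, hXC⟩)] at h

/-! ### 3-connected matroids -/

lemma IsKConnected.two_le_conn [M.Finite] (hM : IsKConnected M 3) (hX : X ⊆ M.E)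
    (h1 : 2 ≤ X.ncard) (h2 : 2 ≤ (M.E \ X).ncard) : 2 ≤ conn M X := by
  by_contra! h
  refine hM 2 (by norm_num) X (M.E \ X) ⟨union_sdiff_cancel hX, disjoint_sdiff_right, ?_, ?_, h⟩
  · rw [← (M.ground_finite.subset hX).cast_ncard_eq]; exact_mod_cast h1
  · rw [← (M.ground_finite.sdiff).cast_ncard_eq]; exact_mod_cast h2

lemma IsKConnected.one_le_conn [M.Finite] (hM : IsKConnected M 3) (hX : X ⊆ M.E)
    (h1 : 1 ≤ X.ncard) (h2 : 1 ≤ (M.E \ X).ncard) : 1 ≤ conn M X := by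
  by_contra! h
  refine hM 1 (by norm_num) X (M.E \ X) ⟨union_sdiff_cancel hX, disjoint_sdiff_right, ?_, ?_, h⟩
  · rw [← (M.ground_finite.subset hX).cast_ncard_eq]; exact_mod_cast h1
  · rw [← (M.ground_finite.sdiff).cast_ncard_eq]; exact_mod_cast h2

lemma exists_of_not_isKConnected [M.Finite] (hM : ¬ IsKConnected M 3) :
    ∃ X ⊆ M.E, ∃ k ≤ 2, k ≤ X.ncard ∧ k ≤ (M.E \ X).ncard ∧ conn M X < k := by
  simp only [IsKConnected, not_forall, not_not] at hM
  obtain ⟨k, hk, X, Y, h⟩ := hM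
  have hX : X ⊆ M.E := h.union_eq ▸ subset_union_left
  have hY : Y = M.E \ X := by
    rw [← h.union_eq, union_sdiff_left, h.disjoint.sdiff_eq_right]
  refine ⟨X, hX, k, by omega, ?_, ?_, h.conn_lt⟩
  · have := h.le_left
    rw [← (M.ground_finite.subset hX).cast_ncard_eq] at this; exact_mod_cast this
  · have := h.le_right
    rw [hY, ← (M.ground_finite.sdiff).cast_ncard_eq] at this; exact_mod_cast this

lemma IsKConnected.dual [M.Finite] (hM : IsKConnected M 3) : IsKConnected M✶ 3 := by
  intro k hk X Y h
  have hX : X ⊆ M.E := by have := h.union_eq; rw [Matroid.dual_ground] at this; rw [← this]; simp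
  exact hM k hk X Y ⟨h.union_eq, h.disjoint, h.le_left, h.le_right, conn_dual M hX ▸ h.conn_lt⟩

lemma isKConnected_dual_iff [M.Finite] : IsKConnected M✶ 3 ↔ IsKConnected M 3 :=
  ⟨fun h ↦ by simpa using h.dual, IsKConnected.dual⟩

lemma conn_lt_ncard_of_dep [M.Finite] (h : M.Dep X) : conn M X < X.ncard := by
  have h1 := conn_add_ncard M h.subset_ground
  have h2 := rk_le_ncard M✶ (X := X) h.subset_ground
  have h3 := (rk_lt_ncard_iff_dep M h.subset_ground).2 h
  omega

/-- A 3-connected matroid with at least four elements has no dependent set of size at most two. -/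
lemma IsKConnected.three_le_ncard_of_dep [M.Finite] (hM : IsKConnected M 3)
    (hE : 4 ≤ M.E.ncard) (h : M.Dep X) : 3 ≤ X.ncard := by
  have hX := h.subset_ground
  have h1 := conn_lt_ncard_of_dep h
  have h2 := ncard_sdiff_add_ncard_of_subset hX M.ground_finite
  by_contra! h3
  obtain h4 | h4 : X.ncard = 1 ∨ X.ncard = 2 := by omega
  · have := hM.one_le_conn hX (by omega) (by omega); omega
  · have := hM.two_le_conn hX (by omega) (by omega); omega

end MatroidTangle

namespace MatroidTangle

variable {α : Type*} {M N : Matroid α} {X Y A B C D : Set α} {e x y : α} {T : Set (Set α)} {θ : ℕ}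

/-! ### Tangles -/

lemma IsTangle.dual [M.Finite] (hT : IsTangle M T θ) : IsTangle M✶ T θ where
  subset_ground := hT.subset_ground
  conn_lt X hX := by rw [conn_dual M (hT.subset_ground X hX)]; exact hT.conn_lt X hX
  mem_or_compl_mem X hX h := hT.mem_or_compl_mem X hX (by rwa [conn_dual M hX] at h)
  union_ne := hT.union_ne
  compl_singleton_notMem := hT.compl_singleton_notMem

lemma IsTangle.tangleRank_dual [M.Finite] (hT : IsTangle M T θ) (X : Set α) :
    tangleRank M✶ T θ X = tangleRank M T θ X := by
  have h : {n | ∃ Y ∈ T, X ⊆ Y ∧ conn M✶ Y = n} = {n | ∃ Y ∈ T, X ⊆ Y ∧ conn M Y = n} := by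
    ext n
    refine exists_congr fun Y ↦ and_congr_right fun hY ↦ ?_
    rw [conn_dual M (hT.subset_ground Y hY)]
  simp only [tangleRank, h]

lemma tangleRank_le_conn (hY : Y ∈ T) (h : X ⊆ Y) : tangleRank M T θ X ≤ conn M Y := by
  rw [tangleRank, if_pos ⟨Y, hY, h⟩]
  exact Nat.sInf_le ⟨Y, hY, h, rfl⟩

lemma exists_conn_eq_tangleRank (h : ∃ Y ∈ T, X ⊆ Y) :
    ∃ Y ∈ T, X ⊆ Y ∧ conn M Y = tangleRank M T θ X := by
  rw [tangleRank, if_pos h]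
  obtain ⟨Y, hY, hXY⟩ := h
  exact Nat.sInf_mem (s := {n | ∃ Y ∈ T, X ⊆ Y ∧ conn M Y = n}) ⟨_, Y, hY, hXY, rfl⟩

lemma IsTangle.tangleRank_le (hT : IsTangle M T θ) (X : Set α) : tangleRank M T θ X ≤ θ := by
  by_cases h : ∃ Y ∈ T, X ⊆ Y
  · obtain ⟨Y, hY, hXY⟩ := h
    exact (tangleRank_le_conn hY hXY).trans (hT.conn_lt Y hY).le
  · rw [tangleRank, if_neg h]

lemma exists_of_tangleRank_lt (h : tangleRank M T θ X < θ) :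
    ∃ Y ∈ T, X ⊆ Y ∧ conn M Y = tangleRank M T θ X := by
  refine exists_conn_eq_tangleRank ?_
  by_contra h'
  rw [tangleRank, if_neg h'] at h
  exact h.false

lemma IsTangle.tangleRank_mono (hT : IsTangle M T θ) (h : X ⊆ Y) :
    tangleRank M T θ X ≤ tangleRank M T θ Y := by
  by_cases hY : tangleRank M T θ Y < θ
  · obtain ⟨Z, hZ, hYZ, hc⟩ := exists_of_tangleRank_lt hY
    exact hc ▸ tangleRank_le_conn hZ (h.trans hYZ)
  · exact (hT.tangleRank_le X).trans (not_lt.1 hY)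

lemma IsTangle.mem_of_subset (hT : IsTangle M T θ) (hY : Y ∈ T) (h : X ⊆ Y)
    (hc : conn M X < θ) : X ∈ T := by
  have hYE := hT.subset_ground Y hY
  refine (hT.mem_or_compl_mem X (h.trans hYE) hc).resolve_right fun h' ↦ ?_
  exact hT.union_ne _ h' Y hY Y hY (by tauto_set)

lemma IsTangle.union_mem (hT : IsTangle M T θ) (hX : X ∈ T) (hY : Y ∈ T)
    (hc : conn M (X ∪ Y) < θ) : X ∪ Y ∈ T := by
  have hXE := hT.subset_ground X hX
  have hYE := hT.subset_ground Y hY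
  refine (hT.mem_or_compl_mem _ (union_subset hXE hYE) hc).resolve_right fun h' ↦ ?_
  exact hT.union_ne _ h' X hX Y hY (by tauto_set)

lemma IsTangle.singleton_mem (hT : IsTangle M T θ) (he : e ∈ M.E) (hc : conn M {e} < θ) :
    {e} ∈ T :=
  (hT.mem_or_compl_mem _ (singleton_subset_iff.2 he) hc).resolve_right
    (hT.compl_singleton_notMem e he)

lemma IsTangle.insert_mem [M.Finite] (hT : IsTangle M T θ) (hθ : 2 ≤ θ) (hX : X ∈ T)
    (he : e ∈ M.E) (hc : conn M (insert e X) < θ) : insert e X ∈ T := by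
  have h := conn_le_ncard M (singleton_subset_iff.2 he)
  rw [ncard_singleton] at h
  rw [← union_singleton] at hc ⊢
  exact hT.union_mem hX (hT.singleton_mem he (by omega)) hc

lemma IsTangle.mem_of_ncard_lt [M.Finite] (hT : IsTangle M T θ) (hX : X ⊆ M.E)
    (h : X.ncard < θ) : X ∈ T := by
  induction X, M.ground_finite.subset hX using Set.Finite.induction_on with
  | empty =>
    have h0 := conn_le_ncard M (empty_subset M.E)
    refine (hT.mem_or_compl_mem ∅ (empty_subset _) (by omega)).resolve_right fun h' ↦ ?_
    exact hT.union_ne _ h' _ h' _ h' (by simp)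
  | @insert e X heX hXfin ih =>
    rw [ncard_insert_of_notMem heX hXfin] at h
    rw [insert_subset_iff] at hX
    have hc := conn_le_ncard M (insert_subset_iff.2 hX)
    rw [ncard_insert_of_notMem heX hXfin] at hc
    exact hT.insert_mem (by omega) (ih hX.2 (by omega)) hX.1 (by omega)

/-- The set splits into two sets of at most `θ - 1` elements, each a member of `T`, and a union of
two members is a member when its connectivity is below `θ`. -/
lemma IsTangle.mem_of_ncard_le [M.Finite] (hT : IsTangle M T θ) (hX : X ⊆ M.E)
    (h : X.ncard + 2 ≤ 2 * θ) (hc : conn M X < θ) : X ∈ T := by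
  by_cases hlt : X.ncard < θ
  · exact hT.mem_of_ncard_lt hX hlt
  obtain ⟨A, hAX, hA⟩ := exists_subset_card_eq (s := X) (n := θ - 1) (by omega)
  have hfin := M.ground_finite.subset hX
  have hB := ncard_sdiff_add_ncard_of_subset hAX hfin
  rw [← union_sdiff_cancel hAX] at hc ⊢
  exact hT.union_mem (hT.mem_of_ncard_lt (hAX.trans hX) (by omega))
    (hT.mem_of_ncard_lt (sdiff_subset.trans hX) (by omega)) hc

lemma IsTangle.tangleRank_le_conn_of_ncard_le [M.Finite] (hT : IsTangle M T θ) (hX : X ⊆ M.E)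
    (h : X.ncard + 2 ≤ 2 * θ) : tangleRank M T θ X ≤ conn M X := by
  by_cases hc : conn M X < θ
  · exact tangleRank_le_conn (hT.mem_of_ncard_le hX h hc) Subset.rfl
  · exact (hT.tangleRank_le X).trans (not_lt.1 hc)

/-- Uncrossing of optimal members `A ⊇ X` and `B ⊇ Y`: `A ∩ B` and `A ∪ B` are again in `T` unless
their connectivity reaches `θ`, which bounds the tangle rank anyway. -/
lemma IsTangle.tangleRank_inter_add_tangleRank_union_le [M.Finite] (hT : IsTangle M T θ)
    (X Y : Set α) : tangleRank M T θ (X ∩ Y) + tangleRank M T θ (X ∪ Y) ≤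
      tangleRank M T θ X + tangleRank M T θ Y := by
  by_cases hX : tangleRank M T θ X < θ
  swap
  · have h1 := hT.tangleRank_le (X ∪ Y)
    have h2 := hT.tangleRank_mono (inter_subset_right (s := X) (t := Y))
    omega
  by_cases hY : tangleRank M T θ Y < θ
  swap
  · have h1 := hT.tangleRank_le (X ∪ Y)
    have h2 := hT.tangleRank_mono (inter_subset_left (s := X) (t := Y))
    omega
  obtain ⟨A, hA, hXA, hcA⟩ := exists_of_tangleRank_lt hX
  obtain ⟨B, hB, hYB, hcB⟩ := exists_of_tangleRank_lt hY
  have h := conn_inter_add_conn_union_le M A B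
  have h1 : tangleRank M T θ (X ∩ Y) ≤ conn M (A ∩ B) := by
    by_cases hc : conn M (A ∩ B) < θ
    · exact tangleRank_le_conn (hT.mem_of_subset hA inter_subset_left hc)
        (inter_subset_inter hXA hYB)
    · exact (hT.tangleRank_le _).trans (not_lt.1 hc)
  have h2 : tangleRank M T θ (X ∪ Y) ≤ conn M (A ∪ B) := by
    by_cases hc : conn M (A ∪ B) < θ
    · exact tangleRank_le_conn (hT.union_mem hA hB hc) (union_subset_union hXA hYB)
    · exact (hT.tangleRank_le _).trans (not_lt.1 hc)
  omega

lemma IsTangle.tangleRank_singleton_le [M.Finite] (hT : IsTangle M T θ) (he : e ∈ M.E) :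
    tangleRank M T θ {e} ≤ 1 := by
  have h := conn_le_ncard M (singleton_subset_iff.2 he)
  rw [ncard_singleton] at h
  by_cases hθ : θ ≤ 1
  · exact (hT.tangleRank_le _).trans hθ
  · exact (tangleRank_le_conn (hT.singleton_mem he (by omega)) Subset.rfl).trans h

lemma IsTangle.tangleRank_union_le_add_ncard [M.Finite] (hT : IsTangle M T θ) (X : Set α)
    (hY : Y ⊆ M.E) : tangleRank M T θ (X ∪ Y) ≤ tangleRank M T θ X + Y.ncard := by
  induction Y, M.ground_finite.subset hY using Set.Finite.induction_on with
  | empty => simp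
  | @insert e Y heY hYfin ih =>
    rw [insert_subset_iff] at hY
    have h1 := ih hY.2
    have h2 := hT.tangleRank_inter_add_tangleRank_union_le (X ∪ Y) {e}
    have h3 := hT.tangleRank_singleton_le hY.1
    rw [ncard_insert_of_notMem heY hYfin]
    rw [union_singleton, ← union_insert] at h2
    omega

lemma IsTangle.two_le_ncard_compl [M.Finite] (hT : IsTangle M T θ) (hY : Y ∈ T) :
    2 ≤ (M.E \ Y).ncard := by
  have hYE := hT.subset_ground Y hY
  by_contra! h
  obtain h0 | h1 : (M.E \ Y).ncard = 0 ∨ (M.E \ Y).ncard = 1 := by omega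
  · rw [ncard_eq_zero M.ground_finite.sdiff] at h0
    exact hT.union_ne Y hY Y hY Y hY (by tauto_set)
  · obtain ⟨e, he⟩ := ncard_eq_one.1 h1
    have heE : e ∈ M.E := (he ▸ mem_singleton e : e ∈ M.E \ Y).1
    refine hT.compl_singleton_notMem e heE ?_
    rwa [← he, show M.E \ (M.E \ Y) = Y by tauto_set]

/-- The link between `M` and its tangle matroid: a dependent set has connectivity below its size.
Its contrapositive turns independence in the tangle into independence in `M`, and by duality into
coindependence. -/
lemma IsTangle.tangleRank_lt_ncard_of_dep [M.Finite] (hT : IsTangle M T θ) (hθ : 2 ≤ θ)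
    (hX : M.Dep X) : tangleRank M T θ X < X.ncard := by
  by_cases h : θ < X.ncard
  · exact (hT.tangleRank_le X).trans_lt h
  · exact (hT.tangleRank_le_conn_of_ncard_le hX.subset_ground (by omega)).trans_lt
      (conn_lt_ncard_of_dep hX)

lemma IsTangle.two_le_tangleRank [M.Finite] (hT : IsTangle M T θ) (hθ : 2 ≤ θ)
    (hM : IsKConnected M 3) (hX : 2 ≤ X.ncard) : 2 ≤ tangleRank M T θ X := by
  by_contra! h
  obtain ⟨Y, hY, hXY, hc⟩ := exists_of_tangleRank_lt (h.trans_le hθ)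
  have hYE := hT.subset_ground Y hY
  have h1 := ncard_le_ncard hXY (M.ground_finite.subset hYE)
  have h2 := hM.two_le_conn hYE (by omega) (hT.two_le_ncard_compl hY)
  omega

lemma IsTangle.one_le_tangleRank [M.Finite] (hT : IsTangle M T θ) (hθ : 2 ≤ θ)
    (hM : IsKConnected M 3) (hX : 1 ≤ X.ncard) : 1 ≤ tangleRank M T θ X := by
  by_contra! h
  obtain ⟨Y, hY, hXY, hc⟩ := exists_of_tangleRank_lt (h.trans (by omega : 1 < θ))
  have hYE := hT.subset_ground Y hY
  have h1 := ncard_le_ncard hXY (M.ground_finite.subset hYE)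
  have h2 := hM.one_le_conn hYE (by omega) (by have := hT.two_le_ncard_compl hY; omega)
  omega

end MatroidTangle

namespace MatroidTangle

variable {α : Type*} {M N : Matroid α} {X Y A B C D C₁ D₁ J J' K : Set α} {c d e f g x y : α}
  {T : Set (Set α)} {θ : ℕ}

/-! ### Minors that are freely placed in a tangle -/

/-- `M ／ C ＼ D` is a 3-connected minor of the 3-connected matroid `M` with `N` as a minor, and
`C ∪ D` is independent in the tangle matroid of `T` after contracting the ground set of `N`. -/
structure IsFreeMinor (M N : Matroid α) (T : Set (Set α)) (θ : ℕ) (C D : Set α) : Prop where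
  conn3 : IsKConnected M 3
  tangle : IsTangle M T θ
  left_subset : C ⊆ M.E
  right_subset : D ⊆ M.E
  disjoint : Disjoint C D
  minor_conn3 : IsKConnected (M ／ C ＼ D) 3
  isMinor : N ≤m M ／ C ＼ D
  rank_eq : tangleRank M T θ (N.E ∪ C ∪ D) = tangleRank M T θ N.E + (C ∪ D).ncard
  four_le : 4 ≤ (C ∪ D).ncard

/-- `J` is a circuit of `M` containing `d` and `g` and otherwise contained in `C`. -/
structure IsCircuitVia (M : Matroid α) (C : Set α) (d g : α) (J : Set α) : Prop where
  isCircuit : M.IsCircuit J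
  mem_left : d ∈ J
  mem_right : g ∈ J
  subset : J ⊆ insert d (insert g C)

lemma IsCircuitVia.mono (h : IsCircuitVia M C₁ d g J) (hC : C₁ ⊆ C) : IsCircuitVia M C d g J :=
  ⟨h.isCircuit, h.mem_left, h.mem_right,
    h.subset.trans (insert_subset_insert (insert_subset_insert hC))⟩

lemma minor_ground (M : Matroid α) (C D : Set α) : (M ／ C ＼ D).E = M.E \ (C ∪ D) := by
  simp only [Matroid.delete_ground, Matroid.contract_ground]
  tauto_set

lemma ncard_pair_le (a b : α) : ({a, b} : Set α).ncard ≤ 2 :=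
  (ncard_insert_le a {b}).trans (by simp)

lemma isMinor_dual (h : N ≤m M) : N✶ ≤m M✶ := by
  obtain ⟨C, D, -, -, hCD, rfl⟩ := h.exists_eq_contract_delete_disjoint
  exact ⟨D, C, by rw [Matroid.contract_delete_comm _ hCD, Matroid.dual_delete_contract]⟩

namespace IsFreeMinor

lemma dual [M.Finite] (h : IsFreeMinor M N T θ C D) : IsFreeMinor M✶ N✶ T θ D C where
  conn3 := h.conn3.dual
  tangle := h.tangle.dual
  left_subset := h.right_subset
  right_subset := h.left_subset
  disjoint := h.disjoint.symm
  minor_conn3 := by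
    rw [← Matroid.dual_delete_contract, ← Matroid.contract_delete_comm _ h.disjoint]
    exact h.minor_conn3.dual
  isMinor := by
    rw [← Matroid.dual_delete_contract, ← Matroid.contract_delete_comm _ h.disjoint]
    exact isMinor_dual h.isMinor
  rank_eq := by
    rw [h.tangle.tangleRank_dual, h.tangle.tangleRank_dual, union_comm D C, Matroid.dual_ground,
      union_right_comm]
    exact h.rank_eq
  four_le := by rw [union_comm]; exact h.four_le

lemma union_subset_ground (h : IsFreeMinor M N T θ C D) : C ∪ D ⊆ M.E :=
  union_subset h.left_subset h.right_subset

lemma ncard_le (h : IsFreeMinor M N T θ C D) : (C ∪ D).ncard ≤ θ := by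
  have h1 := h.rank_eq
  have h2 := h.tangle.tangleRank_le (N.E ∪ C ∪ D)
  omega

lemma four_le_order (h : IsFreeMinor M N T θ C D) : 4 ≤ θ := h.four_le.trans h.ncard_le

variable [M.Finite]

lemma tangleRank_union (h : IsFreeMinor M N T θ C D) (hA : A ⊆ C ∪ D) :
    tangleRank M T θ (N.E ∪ A) = tangleRank M T θ N.E + A.ncard := by
  have hfin := M.ground_finite.subset h.union_subset_ground
  have h1 := h.tangle.tangleRank_union_le_add_ncard N.E (hA.trans h.union_subset_ground)
  have h2 := h.tangle.tangleRank_union_le_add_ncard (N.E ∪ A)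
    (sdiff_subset.trans h.union_subset_ground : (C ∪ D) \ A ⊆ M.E)
  have h3 := h.rank_eq
  have h4 := ncard_sdiff_add_ncard_of_subset hA hfin
  rw [show N.E ∪ A ∪ (C ∪ D) \ A = N.E ∪ C ∪ D by tauto_set] at h2
  omega

lemma ncard_le_tangleRank (h : IsFreeMinor M N T θ C D) (hA : A ⊆ C ∪ D) :
    A.ncard ≤ tangleRank M T θ A := by
  have h1 := h.tangleRank_union hA
  have h2 := h.tangle.tangleRank_inter_add_tangleRank_union_le N.E A
  omega

lemma indep (h : IsFreeMinor M N T θ C D) (hA : A ⊆ C ∪ D) : M.Indep A := by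
  by_contra hi
  have hd : M.Dep A := ⟨hi, hA.trans h.union_subset_ground⟩
  have h1 := h.ncard_le_tangleRank hA
  have h2 := h.tangle.tangleRank_lt_ncard_of_dep (by have := h.four_le_order; omega) hd
  omega

/-- Otherwise the complement, one element of `C ∪ D` and the remaining elements of `C ∪ D` are three
sets of fewer than `θ` elements, hence members of `T`, that cover the ground set. -/
lemma four_le_ncard_compl (h : IsFreeMinor M N T θ C D) : 4 ≤ (M.E \ (C ∪ D)).ncard := by
  by_contra! hlt
  have hZ := h.union_subset_ground
  have h1 := h.tangle.mem_of_ncard_lt (X := M.E \ (C ∪ D)) sdiff_subset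
    (hlt.trans_le h.four_le_order)
  have h4 := h.four_le
  obtain ⟨A, hA, hAc⟩ := exists_subset_card_eq (s := C ∪ D) (n := 1) (by omega)
  have h5 := ncard_sdiff_add_ncard_of_subset hA (M.ground_finite.subset hZ)
  have h6 := h.ncard_le
  have h2 := h.tangle.mem_of_ncard_lt (hA.trans hZ) (by omega)
  have h3 := h.tangle.mem_of_ncard_lt (X := (C ∪ D) \ A) (sdiff_subset.trans hZ) (by omega)
  exact h.tangle.union_ne _ h1 _ h2 _ h3 (by tauto_set)

lemma four_le_ncard_ground (h : IsFreeMinor M N T θ C D) : 4 ≤ (M ／ C ＼ D).E.ncard := by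
  rw [minor_ground]
  exact h.four_le_ncard_compl

lemma four_le_ncard (h : IsFreeMinor M N T θ C D) : 4 ≤ M.E.ncard :=
  h.four_le_ncard_compl.trans (ncard_le_ncard sdiff_subset M.ground_finite)

/-- In the tangle matroid, an element spanned by two subsets of the independent set `C ∪ D` is
spanned by their intersection. -/
lemma tangleRank_insert_inter_le (h : IsFreeMinor M N T θ C D) (hA : A ⊆ C ∪ D) (hB : B ⊆ C ∪ D)
    (hxA : tangleRank M T θ (insert x A) ≤ A.ncard)
    (hxB : tangleRank M T θ (insert x B) ≤ B.ncard) :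
    tangleRank M T θ (insert x (A ∩ B)) ≤ (A ∩ B).ncard := by
  have hfin := M.ground_finite.subset h.union_subset_ground
  have h1 := h.tangle.tangleRank_inter_add_tangleRank_union_le (insert x A) (insert x B)
  rw [← insert_inter_distrib, ← insert_union_distrib] at h1
  have h2 := h.tangle.tangleRank_mono (subset_insert x (A ∪ B))
  have h3 := h.ncard_le_tangleRank (union_subset hA hB)
  have h4 := ncard_union_add_ncard_inter A B (hfin.subset hA) (hfin.subset hB)
  omega

/-! ### Circuits and cocircuits that obstruct restoration -/

lemma three_le_ncard_circuit_sdiff (h : IsFreeMinor M N T θ C D) (hJ : M.IsCircuit J)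
    (hJD : Disjoint J D) : 3 ≤ (J \ C).ncard := by
  have hJC : ¬ J ⊆ C := fun hs ↦ hJ.not_indep (h.indep (hs.trans subset_union_left))
  refine h.minor_conn3.three_le_ncard_of_dep h.four_le_ncard_ground ?_
  rw [Matroid.delete_dep_iff]
  exact ⟨hJ.contract_dep_of_not_subset hJC, hJD.mono_left sdiff_subset⟩

lemma three_le_ncard_circuit (h : IsFreeMinor M N T θ C D) (hJ : M.IsCircuit J) : 3 ≤ J.ncard :=
  h.conn3.three_le_ncard_of_dep h.four_le_ncard hJ.dep

/-- Eliminating `d` from two such circuits would leave a circuit in `C ∪ {x, y}`, that is, a loop or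
parallel pair of `M ／ C ＼ D`. -/
lemma circuitVia_unique (h : IsFreeMinor M N T θ C D) (hg : x ∉ C ∪ D) (hf : y ∉ C ∪ D)
    (hJ : IsCircuitVia M C d x J) (hJ' : IsCircuitVia M C d y J') : J = J' := by
  by_contra hne
  obtain ⟨L, hLs, hL⟩ := hJ.isCircuit.elimination hJ'.isCircuit hne d
  have hLsub : L ⊆ C ∪ {x, y} := by
    intro z hz
    obtain ⟨h1 | h1, hzd⟩ := hLs hz
    · rcases hJ.subset h1 with h2 | rfl | h2
      exacts [absurd h2 hzd, Or.inr (Or.inl rfl), Or.inl h2]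
    · rcases hJ'.subset h1 with h2 | rfl | h2
      exacts [absurd h2 hzd, Or.inr (Or.inr rfl), Or.inl h2]
  have hdis : Disjoint L D := by
    rw [Set.disjoint_left]
    intro z hz hzD
    have hzC : z ∉ C := fun hc ↦ h.disjoint.le_bot ⟨hc, hzD⟩
    rcases hLsub hz with h1 | rfl | rfl
    · exact hzC h1
    · exact hg (Or.inr hzD)
    · exact hf (Or.inr hzD)
  have h3 := h.three_le_ncard_circuit_sdiff hL hdis
  have h4 := ncard_le_ncard (sdiff_subset_iff.2 hLsub) (by simp)
  have h5 := ncard_pair_le x y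
  omega

/-- By orthogonality `J` and `K` share an element besides `c`. It is `d`, or else `f = g`, and the
tangle excludes the latter when `d ∉ K`. -/
lemma mem_cocircuit_of_mem_circuit (h : IsFreeMinor M N T θ C D) (hc : c ∈ C) (hd : d ∈ D)
    (hf : f ∉ C ∪ D) (hg : g ∉ C ∪ D) (hK : IsCircuitVia M✶ D c f K)
    (hJ : IsCircuitVia M C d g J) (hcJ : c ∈ J) : d ∈ K := by
  by_contra hdK
  have hnt := hJ.isCircuit.isCocircuit_inter_nontrivial hK.isCircuit ⟨c, hcJ, hK.mem_left⟩
  obtain ⟨z, ⟨hzJ, hzK⟩, hzc⟩ := hnt.exists_ne c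
  have hCD : ∀ z, z ∈ C → z ∈ D → False := fun z h1 h2 ↦ h.disjoint.le_bot ⟨h1, h2⟩
  have hzfg : z = f ∧ z = g := by
    rcases hJ.subset hzJ with rfl | hz1 | hz1 <;> rcases hK.subset hzK with hz2 | hz2 | hz2
    · exact absurd hz2 hzc
    · exact absurd hzK hdK
    · exact absurd hzK hdK
    · exact absurd hz2 hzc
    · exact ⟨hz2, hz1⟩
    · exact absurd (hz1 ▸ Or.inr hz2) hg
    · exact absurd hz2 hzc
    · exact absurd (hz2 ▸ Or.inl hz1) hf
    · exact (hCD z hz1 hz2).elim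
  obtain ⟨rfl, rfl⟩ := hzfg
  -- In the tangle matroid `z` is spanned by `K \ {z}` and by `J \ {z}`, hence by their
  -- intersection, which is `{c}`. This contradicts that two elements have tangle rank at least 2.
  have hθ : 2 ≤ θ := by have := h.four_le_order; omega
  have hK1 := h.tangle.dual.tangleRank_lt_ncard_of_dep hθ hK.isCircuit.dep
  rw [h.tangle.tangleRank_dual] at hK1
  have hJ1 := h.tangle.tangleRank_lt_ncard_of_dep hθ hJ.isCircuit.dep
  have hKfin := M.ground_finite.subset hK.isCircuit.subset_ground
  have hJfin := M.ground_finite.subset hJ.isCircuit.subset_ground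
  have hK2 := ncard_sdiff_singleton_add_one hzK hKfin
  have hJ2 := ncard_sdiff_singleton_add_one hzJ hJfin
  have hKs : K \ {z} ⊆ insert c D := by
    have := hK.subset
    intro w hw
    rcases this hw.1 with h1 | h1 | h1
    · exact Or.inl h1
    · exact absurd h1 hw.2
    · exact Or.inr h1
  have hJs : J \ {z} ⊆ insert d C := by
    have := hJ.subset
    intro w hw
    rcases this hw.1 with h1 | h1 | h1
    · exact Or.inl h1
    · exact absurd h1 hw.2
    · exact Or.inr h1
  have hint : (K \ {z}) ∩ (J \ {z}) ⊆ {c} := by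
    rintro w ⟨hw1, hw2⟩
    rcases hKs hw1 with h1 | h1
    · exact h1
    · rcases hJs hw2 with rfl | h2
      · exact absurd hw1.1 hdK
      · exact (hCD w h2 h1).elim
  have hmeet := h.tangleRank_insert_inter_le (A := K \ {z}) (B := J \ {z}) (x := z)
    (hKs.trans (insert_subset (Or.inl hc) subset_union_right))
    (hJs.trans (insert_subset (Or.inr hd) subset_union_left))
    (by rw [insert_sdiff_singleton, insert_eq_of_mem hzK]; omega)
    (by rw [insert_sdiff_singleton, insert_eq_of_mem hzJ]; omega)
  have h5 := ncard_le_ncard hint (by simp)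
  rw [ncard_singleton] at h5
  have h6 := h.tangle.two_le_tangleRank hθ h.conn3
    (X := insert z (K \ {z} ∩ (J \ {z}))) ?_
  · omega
  · have hsub : ({z, c} : Set α) ⊆ insert z (K \ {z} ∩ (J \ {z})) := by
      rintro w (rfl | rfl)
      · exact Or.inl rfl
      · exact Or.inr ⟨⟨hK.mem_left, hzc.symm⟩, hcJ, hzc.symm⟩
    have := ncard_le_ncard hsub ((hKfin.subset (inter_subset_left.trans sdiff_subset)).insert _)
    rwa [ncard_pair hzc] at this

lemma mem_circuit_iff_mem_cocircuit (h : IsFreeMinor M N T θ C D) (hc : c ∈ C) (hd : d ∈ D)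
    (hf : f ∉ C ∪ D) (hg : g ∉ C ∪ D) (hK : IsCircuitVia M✶ D c f K)
    (hJ : IsCircuitVia M C d g J) : c ∈ J ↔ d ∈ K := by
  refine ⟨h.mem_cocircuit_of_mem_circuit hc hd hf hg hK hJ, fun hdK ↦ ?_⟩
  rw [union_comm] at hf hg
  exact h.dual.mem_cocircuit_of_mem_circuit hd hc hg hf (by simpa using hJ) hK hdK

/-- A dependent set of `M ／ C₁ ＼ D₁` with at most one element in `C ∪ D` and at most one outside
comes from a circuit through both. -/
lemma exists_circuitVia_of_dep (h : IsFreeMinor M N T θ C D) (hC₁ : C₁ ⊆ C)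
    (hX : (M ／ C₁ ＼ D₁).Dep X) (hXZ : (X ∩ (C ∪ D)).ncard ≤ 1)
    (hX0 : (X \ (C ∪ D)).ncard ≤ 1) :
    ∃ x ∈ M.E \ (C ∪ D), ∃ d ∈ D \ D₁, ∃ J, IsCircuitVia M C₁ d x J := by
  rw [Matroid.delete_dep_iff] at hX
  have hCE := hC₁.trans h.left_subset
  have hXE : X ⊆ M.E := hX.1.subset_ground.trans sdiff_subset
  have hXC : Disjoint X C₁ := (subset_sdiff.1 hX.1.subset_ground).2
  have hXfin := M.ground_finite.subset hXE
  obtain ⟨J, hJs, hJ⟩ := (hX.1.of_contract hCE).exists_isCircuit_subset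
  have hJZ : ¬ J ⊆ C ∪ D := fun hs ↦ hJ.not_indep (h.indep hs)
  obtain ⟨x, hxJ, hxZ⟩ := not_subset.1 hJZ
  have hxX : x ∈ X := (hJs hxJ).resolve_left fun hx ↦ hxZ (Or.inl (hC₁ hx))
  have hX0' : ∀ z ∈ X, z ∉ C ∪ D → z = x := fun z hz hzZ ↦
    (ncard_le_one (hXfin.sdiff)).1 hX0 z ⟨hz, hzZ⟩ x ⟨hxX, hxZ⟩
  have hJD : ∃ d ∈ J, d ∈ D := by
    by_contra! hno
    have h3 := h.three_le_ncard_circuit_sdiff hJ (Set.disjoint_left.2 hno)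
    have h4 := ncard_le_ncard (show J \ C ⊆ {x} from fun z hz ↦ by
      rcases hJs hz.1 with h1 | h1
      · exact absurd (hC₁ h1) hz.2
      · exact hX0' z h1 (fun h2 ↦ h2.elim hz.2 (hno z hz.1))) (by simp)
    rw [ncard_singleton] at h4
    omega
  obtain ⟨d, hdJ, hdD⟩ := hJD
  have hdX : d ∈ X := (hJs hdJ).resolve_left fun hd ↦ h.disjoint.le_bot ⟨hC₁ hd, hdD⟩
  refine ⟨x, ⟨hXE hxX, hxZ⟩, d, ⟨hdD, fun h' ↦ hX.2.le_bot ⟨hdX, h'⟩⟩, J, hJ, hdJ, hxJ, ?_⟩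
  intro z hz
  rcases hJs hz with h1 | h1
  · exact Or.inr (Or.inr h1)
  · by_cases hzZ : z ∈ C ∪ D
    · exact Or.inl ((ncard_le_one (hXfin.inter_of_left _)).1 hXZ z ⟨h1, hzZ⟩ d ⟨hdX, Or.inr hdD⟩)
    · exact Or.inr (Or.inl (hX0' z h1 hzZ))

/-- If `X` had two elements in `C ∪ D`, then `X ∪ D₁ ∪ C₁` would have tangle rank at least `2 + |D₁|
+ |C₁|`, but its connectivity is less than `k + |D₁| + |C₁|`. So `X` has at most one element in `C ∪
D` and at most one outside. -/
lemma exists_circuitVia_of_conn_lt (h : IsFreeMinor M N T θ C D) (hC₁ : C₁ ⊆ C) (hD₁ : D₁ ⊆ D)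
    (hX : X ⊆ M.E \ (C₁ ∪ D₁)) {k : ℕ} (hk : k ≤ 2) (hkX : k ≤ X.ncard)
    (hc : conn (M ／ C₁ ＼ D₁) X < k) (hX0 : (X \ (C ∪ D)).ncard ≤ 1) :
    ∃ x ∈ M.E \ (C ∪ D), (∃ d ∈ D \ D₁, ∃ J, IsCircuitVia M C₁ d x J) ∨
      (∃ c ∈ C \ C₁, ∃ K, IsCircuitVia M✶ D₁ c x K) := by
  have hdis : Disjoint C₁ D₁ := h.disjoint.mono hC₁ hD₁
  have hXE : X ⊆ M.E := hX.trans sdiff_subset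
  have hXfin := M.ground_finite.subset hXE
  have hZfin := M.ground_finite.subset h.union_subset_ground
  have hXC₁ : Disjoint X C₁ := (subset_sdiff.1 hX).2.mono_right subset_union_left
  have hXD₁ : Disjoint X D₁ := (subset_sdiff.1 hX).2.mono_right subset_union_right
  have hC₁E := hC₁.trans h.left_subset
  have hD₁E := hD₁.trans h.right_subset
  have hC₁Z : C₁ ⊆ C ∪ D := hC₁.trans subset_union_left
  have hD₁Z : D₁ ⊆ C ∪ D := hD₁.trans subset_union_right
  have hXZ : (X ∩ (C ∪ D)).ncard ≤ 1 := by
    by_contra! hgt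
    have h1 := conn_union_le_conn_delete_add (M ／ C₁) hXD₁
      (by rw [Matroid.contract_ground, subset_sdiff]; exact ⟨hD₁E, hdis.symm⟩)
    have h2 := conn_union_le_conn_contract_add M (X := X ∪ D₁)
      (union_subset hXE hD₁E) (disjoint_union_left.2 ⟨hXC₁, hdis.symm⟩) hC₁E
    have h3 : (X ∪ D₁ ∪ C₁).ncard ≤ (C ∪ D).ncard + 1 := by
      have h31 := ncard_le_ncard (show X ∪ D₁ ∪ C₁ ⊆ (C ∪ D) ∪ X \ (C ∪ D) by
        rw [union_sdiff_self]
        exact union_subset (union_subset subset_union_right (hD₁Z.trans subset_union_left))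
          (hC₁Z.trans subset_union_left)) (hZfin.union hXfin.sdiff)
      have h32 := ncard_union_le (C ∪ D) (X \ (C ∪ D))
      omega
    -- The set has at most `|C ∪ D| + 1 ≤ θ + 1` elements, and `θ + 1 ≤ 2θ - 2`, so its connectivity
    -- bounds its tangle rank.
    have h4 := h.ncard_le
    have h5 := h.four_le
    have h6 := h.tangle.tangleRank_le_conn_of_ncard_le (X := X ∪ D₁ ∪ C₁)
      (union_subset (union_subset hXE hD₁E) hC₁E) (by omega)
    have h7 := h.ncard_le_tangleRank (A := X ∩ (C ∪ D) ∪ D₁ ∪ C₁)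
      (union_subset (union_subset inter_subset_right hD₁Z) hC₁Z)
    have h8 := h.tangle.tangleRank_mono (union_subset_union_left C₁
      (union_subset_union_left D₁ (inter_subset_left : X ∩ (C ∪ D) ⊆ X)))
    have hXZfin : (X ∩ (C ∪ D)).Finite := hXfin.inter_of_left _
    have h9 : (X ∩ (C ∪ D) ∪ D₁ ∪ C₁).ncard = (X ∩ (C ∪ D)).ncard + D₁.ncard + C₁.ncard := by
      rw [ncard_union_eq (disjoint_union_left.2 ⟨hXC₁.mono_left inter_subset_left, hdis.symm⟩)
        (hXZfin.union (hZfin.subset hD₁Z)) (hZfin.subset hC₁Z),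
        ncard_union_eq (hXD₁.mono_left inter_subset_left) hXZfin (hZfin.subset hD₁Z)]
    omega
  have hXE' : X ⊆ (M ／ C₁ ＼ D₁).E := by rwa [minor_ground]
  -- As `conn < k ≤ |X|`, the rank and corank of `X` sum to less than `2|X|`: it is dependent or
  -- codependent.
  have h1 := conn_add_ncard (M ／ C₁ ＼ D₁) hXE'
  by_cases hr : rk (M ／ C₁ ＼ D₁) X < X.ncard
  · obtain ⟨x, hx, hd⟩ := h.exists_circuitVia_of_dep hC₁ ((rk_lt_ncard_iff_dep _ hXE').1 hr) hXZ hX0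
    exact ⟨x, hx, Or.inl hd⟩
  · have hr' : rk (M ／ C₁ ＼ D₁)✶ X < X.ncard := by omega
    rw [rk_lt_ncard_iff_dep _ (by exact hXE'), Matroid.contract_delete_comm _ hdis,
      Matroid.dual_delete_contract] at hr'
    rw [union_comm] at hXZ hX0
    obtain ⟨x, hx, hd⟩ := h.dual.exists_circuitVia_of_dep hD₁ hr' hXZ hX0
    rw [union_comm] at hx
    exact ⟨x, hx, Or.inr hd⟩

/-- If a matroid between `M` and the free minor `M ／ C ＼ D` is not 3-connected, then this is
because of a parallel or series pair. -/
lemma exists_circuitVia_of_not_isKConnected (h : IsFreeMinor M N T θ C D) (hC₁ : C₁ ⊆ C)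
    (hD₁ : D₁ ⊆ D) (hnot : ¬ IsKConnected (M ／ C₁ ＼ D₁) 3) :
    ∃ x ∈ M.E \ (C ∪ D), (∃ d ∈ D \ D₁, ∃ J, IsCircuitVia M C₁ d x J) ∨
      (∃ c ∈ C \ C₁, ∃ K, IsCircuitVia M✶ D₁ c x K) := by
  obtain ⟨X, hX, k, hk, hkX, hkY, hc⟩ := exists_of_not_isKConnected hnot
  have hM0 : M ／ C ＼ D = M ／ C₁ ＼ D₁ ／ (C \ C₁) ＼ (D \ D₁) := by
    rw [Matroid.contract_delete_contract_delete _ _ _ _ _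
      (h.disjoint.mono sdiff_subset hD₁), union_sdiff_cancel hC₁, union_sdiff_cancel hD₁]
  have hXE : X ⊆ M.E \ (C₁ ∪ D₁) := by rwa [minor_ground] at hX
  -- Connectivity does not grow in minors, so 3-connectivity of `M ／ C ＼ D` leaves at most one
  -- element outside `C ∪ D` on one side.
  have hc0 : conn (M ／ C ＼ D) (X \ (C ∪ D)) < 2 := by
    have h1 := conn_contract_le (M ／ C₁ ＼ D₁) (C \ C₁) hX
    have h2 := conn_delete_le (M ／ C₁ ＼ D₁ ／ (C \ C₁)) (D \ D₁) (X := X \ (C \ C₁))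
      (by rw [Matroid.contract_ground]; exact sdiff_subset_sdiff_left hX)
    rw [← hM0, show (X \ (C \ C₁)) \ (D \ D₁) = X \ (C ∪ D) by
      clear * - hC₁ hD₁ hXE; tauto_set] at h2
    omega
  have hE0 : (M ／ C ＼ D).E = M.E \ (C ∪ D) := minor_ground M C D
  by_cases h1 : (X \ (C ∪ D)).ncard ≤ 1
  · exact h.exists_circuitVia_of_conn_lt hC₁ hD₁ hXE hk hkX hc h1
  · refine h.exists_circuitVia_of_conn_lt hC₁ hD₁ (X := (M ／ C₁ ＼ D₁).E \ X)
      (by rw [minor_ground]; exact sdiff_subset) hk hkY (by rwa [conn_compl _ hX]) ?_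
    by_contra! h2
    have h3 := h.minor_conn3.two_le_conn (X := X \ (C ∪ D))
      (by rw [hE0]; exact sdiff_subset_sdiff_left (hXE.trans sdiff_subset)) (by omega) ?_
    · omega
    · rw [hE0]
      rw [minor_ground] at h2
      exact h2.trans_le (ncard_le_ncard (by clear * -; tauto_set) M.ground_finite.sdiff.sdiff)

end IsFreeMinor

end MatroidTangle

namespace MatroidTangle

variable {α : Type*} {M N : Matroid α} {X Y A B C D F J K : Set α} {a b c d e f g w x y : α}
  {T : Set (Set α)} {θ : ℕ}

/-! ### Exchanging parallel elements -/

lemma rk_insert_of_isCircuit (hJ : M.IsCircuit J) (hx : x ∈ J) (hA : J \ {x} ⊆ A) :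
    rk M (insert x A) = rk M A := by
  have h : x ∈ M.closure A :=
    M.closure_subset_closure hA (hJ.mem_closure_sdiff_singleton_of_mem hx)
  rw [rk, rk, ← M.eRk_closure_eq (insert x A), Matroid.closure_insert_eq_of_mem_closure h,
    M.eRk_closure_eq]

lemma rk_insert_eq_of_isCircuit_pair (h : M.IsCircuit {b, x}) (hbx : b ≠ x) (A : Set α) :
    rk M (insert b A) = rk M (insert x A) := by
  rw [← rk_insert_of_isCircuit h (mem_insert_of_mem b rfl) (A := insert b A),
    ← rk_insert_of_isCircuit h (mem_insert b _) (A := insert x A), insert_comm]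
  · rintro z ⟨rfl | rfl, hz⟩
    exacts [absurd rfl hz, Or.inl rfl]
  · rintro z ⟨rfl | rfl, hz⟩
    exacts [Or.inl rfl, absurd rfl hz]

/-- Replacing `b` by `x` turns a separation of `M ＼ {x}` into one of `M ＼ {b}` with the same ranks
and sizes. -/
lemma IsKConnected.delete_of_parallel [M.Finite] (h : M.IsCircuit {b, x}) (hbx : b ≠ x)
    (hM : IsKConnected (M ＼ {b}) 3) : IsKConnected (M ＼ {x}) 3 := by
  have hbE : b ∈ M.E := h.subset_ground (mem_insert b _)
  have hxE : x ∈ M.E := h.subset_ground (mem_insert_of_mem b rfl)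
  by_contra hnot
  have hex : ∃ X ⊆ (M ＼ {x}).E, b ∈ X ∧ ∃ k ≤ 2, k ≤ X.ncard ∧ k ≤ ((M ＼ {x}).E \ X).ncard ∧
      conn (M ＼ {x}) X < k := by
    obtain ⟨X, hX, k, hk, h1, h2, h3⟩ := exists_of_not_isKConnected hnot
    by_cases hbX : b ∈ X
    · exact ⟨X, hX, hbX, k, hk, h1, h2, h3⟩
    · refine ⟨(M ＼ {x}).E \ X, sdiff_subset, ⟨⟨hbE, hbx⟩, hbX⟩, k, hk, h2, ?_, ?_⟩
      · rwa [sdiff_sdiff_cancel_left hX]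
      · rwa [conn_compl _ hX]
  obtain ⟨X, hX, hbX, k, hk, h1, h2, h3⟩ := hex
  rw [Matroid.delete_ground] at hX
  have hXE : X ⊆ M.E := hX.trans sdiff_subset
  have hxX : x ∉ X := fun hx ↦ (hX hx).2 rfl
  have hXfin := M.ground_finite.subset hXE
  set X' := insert x (X \ {b}) with hX'
  have hX'b : Disjoint X' {b} := by
    rw [disjoint_singleton_right]
    rintro (rfl | hb)
    exacts [hbx rfl, hb.2 rfl]
  have hrk : rk M X' = rk M X := by
    rw [hX', ← rk_insert_eq_of_isCircuit_pair h hbx, insert_sdiff_singleton,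
      insert_eq_of_mem hbX]
  have hcard : X'.ncard = X.ncard := by
    rw [hX', ncard_insert_of_notMem (fun hx ↦ hxX hx.1) hXfin.sdiff,
      ncard_sdiff_singleton_add_one hbX hXfin]
  have hcompl : (M.E \ {b}) \ X' = (M.E \ {x}) \ X := by
    ext z
    simp only [hX', mem_sdiff, mem_singleton_iff, mem_insert_iff]
    by_cases hzb : z = b
    · subst hzb; simp [hbX]
    · by_cases hzx : z = x
      · subst hzx; simp
      · simp [hzb, hzx]
  have hrkE : rk M (M.E \ {b}) = rk M (M.E \ {x}) := by
    have h4 := rk_insert_eq_of_isCircuit_pair h hbx (M.E \ {b, x})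
    rwa [show insert b (M.E \ {b, x}) = M.E \ {x} by
      ext z
      simp only [mem_insert_iff, mem_sdiff, mem_singleton_iff]
      by_cases hzb : z = b
      · subst hzb; simp [hbE, hbx]
      · simp [hzb],
      show insert x (M.E \ {b, x}) = M.E \ {b} by
      ext z
      simp only [mem_insert_iff, mem_sdiff, mem_singleton_iff]
      by_cases hzx : z = x
      · subst hzx; simp [hxE, hbx.symm]
      · simp [hzx], eq_comm] at h4
  have hX'E : X' ⊆ (M ＼ {b}).E := by
    rw [Matroid.delete_ground, subset_sdiff]
    exact ⟨insert_subset hxE (sdiff_subset.trans hXE), hX'b⟩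
  have hc1 := conn_add (M ＼ {b}) X'
  have hc2 := conn_add (M ＼ {x}) X
  rw [Matroid.delete_ground, hcompl, rk_delete _ disjoint_sdiff_left, rk_delete _ hX'b,
    rk_delete _ (hcompl ▸ disjoint_sdiff_left.mono_left sdiff_subset)] at hc1
  rw [Matroid.delete_ground, rk_delete _ disjoint_sdiff_left,
    rk_delete _ (disjoint_singleton_right.2 hxX),
    rk_delete _ (disjoint_sdiff_left.mono_left sdiff_subset)] at hc2
  rw [Matroid.delete_ground] at h2
  obtain rfl | rfl : k = 1 ∨ k = 2 := by omega
  · have := hM.one_le_conn hX'E (by omega) (by rwa [Matroid.delete_ground, hcompl])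
    omega
  · have := hM.two_le_conn hX'E (by omega) (by rwa [Matroid.delete_ground, hcompl])
    omega

lemma isMinor_deleteElem_or_contractElem (h : N ≤m M) (hxM : x ∈ M.E) (hxN : x ∉ N.E) :
    N ≤m M ＼ {x} ∨ N ≤m M ／ {x} := by
  obtain ⟨A, B, -, -, hAB, rfl⟩ := h.exists_eq_contract_delete_disjoint
  by_cases hxA : x ∈ A
  · right
    refine ⟨A, B, ?_⟩
    rw [Matroid.contract_contract, singleton_union, insert_eq_of_mem hxA]
  · left
    have hxB : x ∈ B := by
      by_contra hxB
      exact hxN ⟨⟨hxM, hxA⟩, hxB⟩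
    refine ⟨A, B, ?_⟩
    rw [Matroid.contract_delete_comm _ hAB, Matroid.contract_delete_comm _ hAB,
      Matroid.delete_delete, singleton_union, insert_eq_of_mem hxB]

/-- `N` is a minor of `M ＼ {b} ＼ {x}` or `M ＼ {b} ／ {x}`. In the second case, contracting either
element makes the other a loop, so the roles of `b` and `x` can be interchanged. -/
lemma isMinor_delete_of_parallel (h : M.IsCircuit {b, x}) (hbx : b ≠ x) (hN : N ≤m M ＼ {b})
    (hxN : x ∉ N.E) : N ≤m M ＼ {x} := by
  have hxE : x ∈ M.E := h.subset_ground (mem_insert_of_mem b rfl)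
  have hloop : ∀ {p q : α}, M.IsCircuit {p, q} → p ≠ q → {q} ⊆ (M ／ {p}).loops := by
    intro p q hpq hne
    rw [Matroid.contract_loops_eq, singleton_subset_iff]
    refine ⟨?_, fun h' ↦ hne h'.symm⟩
    have := hpq.mem_closure_sdiff_singleton_of_mem (mem_insert_of_mem p rfl)
    refine M.closure_subset_closure ?_ this
    rintro z ⟨rfl | rfl, hz⟩
    exacts [rfl, absurd rfl hz]
  have hdis : ∀ {p q : α}, p ≠ q → Disjoint ({p} : Set α) {q} := by simp
  rcases isMinor_deleteElem_or_contractElem hN ⟨hxE, hbx.symm⟩ hxN with h1 | h1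
  · rw [Matroid.delete_comm] at h1
    exact h1.trans ⟨∅, {b}, by simp⟩
  · rw [← Matroid.contract_delete_comm _ (hdis hbx.symm),
      ← Matroid.contract_eq_delete_of_subset_loops (hloop (pair_comm b x ▸ h) hbx.symm),
      Matroid.contract_comm, Matroid.contract_eq_delete_of_subset_loops (hloop h hbx),
      Matroid.contract_delete_comm _ (hdis hbx)] at h1
    exact h1.trans ⟨{b}, ∅, by simp⟩

namespace IsFreeMinor

variable [M.Finite]

lemma isCircuit_pair_of_circuitVia (h : IsFreeMinor M N T θ C D) (hb : b ∈ D) (hx : x ∉ C ∪ D)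
    (hJ : IsCircuitVia M C b x J) : (M ／ C ＼ (D \ {b})).IsCircuit {b, x} := by
  have hbC : b ∉ C := fun hc ↦ h.disjoint.le_bot ⟨hc, hb⟩
  have hxC : x ∉ C := fun hc ↦ hx (Or.inl hc)
  have hxD : x ∉ D := fun hc ↦ hx (Or.inr hc)
  have hJC : J \ C = {b, x} := by
    ext z
    constructor
    · rintro ⟨hz, hzC⟩
      rcases hJ.subset hz with rfl | rfl | h1
      exacts [Or.inl rfl, Or.inr rfl, absurd h1 hzC]
    · rintro (rfl | rfl)
      exacts [⟨hJ.mem_left, hbC⟩, ⟨hJ.mem_right, hxC⟩]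
  have hdis : Disjoint {b, x} (D \ {b}) := by
    rw [Set.disjoint_left]
    rintro z (rfl | rfl) hz
    exacts [hz.2 rfl, hxD hz.1]
  have hnotb : ¬ (M ／ C ＼ (D \ {b})).Dep {b} := fun hd ↦ by
    rw [Matroid.delete_dep_iff] at hd
    refine (hd.1.of_contract h.left_subset).not_indep (h.indep ?_)
    exact union_subset subset_union_left (singleton_subset_iff.2 (Or.inr hb))
  have hnotx : ¬ (M ／ C ＼ (D \ {b})).Dep {x} := fun hd ↦ by
    rw [Matroid.delete_dep_iff] at hd
    obtain ⟨L, hLs, hL⟩ := (hd.1.of_contract h.left_subset).exists_isCircuit_subset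
    have h1 := h.three_le_ncard_circuit_sdiff hL (Set.disjoint_left.2 fun z hz hzD ↦ by
      rcases hLs hz with h2 | rfl
      exacts [h.disjoint.le_bot ⟨h2, hzD⟩, hxD hzD])
    have h2 := ncard_le_ncard (sdiff_subset_iff.2 hLs) (by simp)
    rw [ncard_singleton] at h2
    omega
  have hdep : (M ／ C ＼ (D \ {b})).Dep {b, x} := by
    rw [Matroid.delete_dep_iff]
    refine ⟨hJC ▸ hJ.isCircuit.contract_dep_of_not_subset ?_, hdis⟩
    exact fun hs ↦ hbC (hs hJ.mem_left)
  rw [Matroid.isCircuit_iff_dep_forall_sdiff_singleton_indep]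
  refine ⟨hdep, ?_⟩
  have hbx : b ≠ x := fun hbx ↦ hxD (hbx ▸ hb)
  rintro e (rfl | rfl)
  · rw [show ({e, x} : Set α) \ {e} = {x} by simp [hbx.symm]]
    by_contra hi
    exact hnotx ⟨hi, (subset_insert e {x}).trans hdep.subset_ground⟩
  · rw [show ({b, e} : Set α) \ {e} = {b} by rw [pair_comm]; simp [hbx]]
    by_contra hi
    exact hnotb ⟨hi, (singleton_subset_iff.2 (mem_insert b _)).trans hdep.subset_ground⟩

/-- Deleting `x` instead of an element `b` parallel to it in the contraction. -/
lemma exchange (h : IsFreeMinor M N T θ C D) (ha : a ∈ C) (hb : b ∈ D) (hx : x ∉ C ∪ D)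
    (hJ : IsCircuitVia M C b x J) (haF : a ∈ F) (hbF : b ∈ F) (hxF : x ∈ F)
    (hF : tangleRank M T θ F ≤ 2) : IsFreeMinor M N T θ C (insert x (D \ {b})) := by
  have hθ : 2 ≤ θ := by have := h.four_le_order; omega
  have hxE : x ∈ M.E := hJ.isCircuit.subset_ground hJ.mem_right
  have hbC : b ∉ C := fun hc ↦ h.disjoint.le_bot ⟨hc, hb⟩
  have hab : a ≠ b := fun hab ↦ hbC (hab ▸ ha)
  have hxD : x ∉ D := fun hc ↦ hx (Or.inr hc)
  have hax : a ≠ x := fun hax ↦ hx (Or.inl (hax ▸ ha))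
  have hbx : b ≠ x := fun hbx ↦ hxD (hbx ▸ hb)
  have hcirc := h.isCircuit_pair_of_circuitVia hb hx hJ
  have hDb : M ／ C ＼ (D \ {b}) ＼ {b} = M ／ C ＼ D := by
    rw [Matroid.delete_delete, sdiff_union_of_subset (singleton_subset_iff.2 hb)]
  have hDx : M ／ C ＼ (D \ {b}) ＼ {x} = M ／ C ＼ (insert x (D \ {b})) := by
    rw [Matroid.delete_delete, union_singleton]
  have hZfin := M.ground_finite.subset h.union_subset_ground
  -- `a` and `b` raise the rank of `N.E` by 2, which is the whole rank of `F`. By submodularity `N.E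
  -- ∩ F` has tangle rank 0, whereas single elements have positive rank.
  have hxN : x ∉ N.E := by
    intro hxN
    have h1 := h.tangle.tangleRank_inter_add_tangleRank_union_le N.E F
    have h2 := h.tangle.tangleRank_mono
      (show N.E ∪ {a, b} ⊆ N.E ∪ F from union_subset_union_right _ (by
        rintro z (rfl | rfl); exacts [haF, hbF]))
    have h3 := h.tangleRank_union (A := {a, b}) (by
      rintro z (rfl | rfl); exacts [Or.inl ha, Or.inr hb])
    have h4 := h.tangle.tangleRank_mono
      (singleton_subset_iff.2 ⟨hxN, hxF⟩ : {x} ⊆ N.E ∩ F)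
    have h5 := h.tangle.one_le_tangleRank hθ h.conn3 (X := {x}) (by simp)
    rw [ncard_pair hab] at h3
    omega
  have hins : insert b (C ∪ insert x (D \ {b})) = insert x (C ∪ D) := by
    ext z
    simp only [mem_insert_iff, mem_union, mem_sdiff, mem_singleton_iff]
    by_cases hzb : z = b
    · simp [hzb, hb]
    · simp only [hzb, not_false_eq_true, and_true, false_or]; tauto
  have hnotb : b ∉ C ∪ insert x (D \ {b}) := by
    rintro (hc | hc | hc)
    exacts [hbC hc, hbx hc, hc.2 rfl]
  have hZ'E : C ∪ insert x (D \ {b}) ⊆ M.E :=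
    union_subset h.left_subset (insert_subset hxE (sdiff_subset.trans h.right_subset))
  have hcard : (C ∪ insert x (D \ {b})).ncard = (C ∪ D).ncard := by
    have h1 := ncard_insert_of_notMem hnotb (M.ground_finite.subset hZ'E)
    have h2 := ncard_insert_of_notMem hx hZfin
    rw [hins] at h1
    omega
  refine ⟨h.conn3, h.tangle, h.left_subset,
    insert_subset hxE (sdiff_subset.trans h.right_subset), ?_, ?_, ?_, ?_, hcard ▸ h.four_le⟩
  · rw [disjoint_insert_right]
    exact ⟨fun hc ↦ hx (Or.inl hc), h.disjoint.mono_right sdiff_subset⟩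
  · rw [← hDx]
    exact IsKConnected.delete_of_parallel hcirc hbx (hDb ▸ h.minor_conn3)
  · rw [← hDx]
    exact isMinor_delete_of_parallel hcirc hbx (hDb ▸ h.isMinor) hxN
  · rw [hcard, union_assoc]
    have h1 := h.tangle.tangleRank_union_le_add_ncard N.E hZ'E
    -- Since `{a, x}` already has rank 2, it spans `F` and hence `b`, so the new set loses no tangle
    -- rank over `N.E`.
    have h2 := h.tangle.tangleRank_inter_add_tangleRank_union_le
      (N.E ∪ (C ∪ insert x (D \ {b}))) F
    have h3 := h.tangle.two_le_tangleRank hθ h.conn3 (X := {a, x}) (by rw [ncard_pair hax])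
    have h4 := h.tangle.tangleRank_mono
      (show {a, x} ⊆ (N.E ∪ (C ∪ insert x (D \ {b}))) ∩ F by
        rintro z (rfl | rfl)
        exacts [⟨Or.inr (Or.inl ha), haF⟩, ⟨Or.inr (Or.inr (Or.inl rfl)), hxF⟩])
    have h5 := h.tangle.tangleRank_mono
      (show N.E ∪ (C ∪ D) ⊆ (N.E ∪ (C ∪ insert x (D \ {b}))) ∪ F by
        rintro z (hz | hz)
        · exact Or.inl (Or.inl hz)
        · have : z ∈ insert b (C ∪ insert x (D \ {b})) := hins ▸ Or.inr hz
          rcases this with rfl | h6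
          exacts [Or.inr hbF, Or.inl (Or.inr h6)])
    have h6 := h.tangleRank_union Subset.rfl
    omega

end IsFreeMinor

/-! ### Fans -/

/-- `F` is a fan-like set in the tangle with a triad through `a` and `b`, at the end of which lies
`a`. -/
structure IsFanEnd (M : Matroid α) (T : Set (Set α)) (a b : α) (F : Set α) : Prop where
  left_mem : a ∈ F
  right_mem : b ∈ F
  exists_triad : ∃ w ∈ F, M✶.IsCircuit {a, b, w}
  mem : F ∈ T
  conn_le : conn M F ≤ 2
  conn_sdiff_le : conn M (F \ {a}) ≤ 2

/-- One step along a fan: the triangle at the end `a` must be `{a, b, x}` with `x` new, so `x` can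
replace `b`. The enlarged fan ends at `x`, and the roles of triangles and triads are swapped. -/
lemma IsFreeMinor.exists_isFanEnd_dual [M.Finite] (h : IsFreeMinor M N T θ C D) (ha : a ∈ C)
    (hb : b ∈ D) (hF : IsFanEnd M T a b F) (hJ : M.IsCircuit J) (haJ : a ∈ J)
    (hJ3 : J.ncard = 3) : ∃ x, x ∈ M.E ∧ x ∉ F ∧ x ∉ C ∪ D ∧
      IsFreeMinor M N T θ C (insert x (D \ {b})) ∧ IsFanEnd M✶ T x a (insert x F) := by
  have hθ := h.four_le_order
  obtain ⟨w, hwF, hK⟩ := hF.exists_triad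
  have hFE := h.tangle.subset_ground F hF.mem
  have hFfin := M.ground_finite.subset hFE
  have hJfin := M.ground_finite.subset hJ.subset_ground
  have hab : a ≠ b := fun hab ↦ h.disjoint.le_bot ⟨ha, hab ▸ hb⟩
  -- If `J ⊆ F`, then removing `a` changes neither the rank nor the corank of `F`, so `conn M (F \
  -- {a}) = conn M F + 1 ≥ 3`.
  have hJF : ¬ J ⊆ F := fun hs ↦ by
    have h1 := rk_insert_of_isCircuit hJ haJ (sdiff_subset_sdiff_left hs)
    have h2 := rk_insert_of_isCircuit hK (mem_insert a _) (A := F \ {a})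
      (sdiff_subset_sdiff_left (by
        rintro z (rfl | rfl | rfl)
        exacts [hF.left_mem, hF.right_mem, hwF]))
    rw [insert_sdiff_singleton, insert_eq_of_mem hF.left_mem] at h1 h2
    have h3 := conn_add_ncard M hFE
    have h4 := conn_add_ncard M (X := F \ {a}) (sdiff_subset.trans hFE)
    have h5 := ncard_sdiff_singleton_add_one hF.left_mem hFfin
    have h6 := hF.conn_sdiff_le
    have h7 := ncard_le_ncard hs hFfin
    have h8 := h.conn3.two_le_conn hFE (by omega) (h.tangle.two_le_ncard_compl hF.mem)
    omega
  obtain ⟨x, hxJ, hxF⟩ := not_subset.1 hJF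
  have hxE := hJ.subset_ground hxJ
  have hnt := hJ.isCocircuit_inter_nontrivial hK ⟨a, haJ, mem_insert a _⟩
  obtain ⟨y, ⟨hyJ, hyK⟩, hya⟩ := hnt.exists_ne a
  have hyF : y ∈ F := by
    rcases hyK with rfl | rfl | rfl
    exacts [hF.left_mem, hF.right_mem, hwF]
  have hxa : x ≠ a := fun hxa ↦ hxF (hxa ▸ hF.left_mem)
  have hxb : x ≠ b := fun hxb ↦ hxF (hxb ▸ hF.right_mem)
  have hxy : x ≠ y := fun hxy ↦ hxF (hxy ▸ hyF)
  have hJeq : J = {a, y, x} := by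
    refine (eq_of_subset_of_ncard_le ?_ ?_ hJfin).symm
    · rintro z (rfl | rfl | rfl) <;> assumption
    · rw [hJ3, ncard_eq_three.2 ⟨a, y, x, hya.symm, hxa.symm, hxy.symm, rfl⟩]
  have hcx : conn M (insert x F) ≤ 2 := by
    have h1 := rk_insert_of_isCircuit hJ hxJ (A := F) (by
      rw [hJeq]
      rintro z ⟨rfl | rfl | rfl, hz⟩
      exacts [hF.left_mem, hyF, absurd rfl hz])
    have h2 := rk_mono M (sdiff_subset_sdiff_right (subset_insert x F) : M.E \ insert x F ⊆ M.E \ F)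
    have h3 := conn_add M F
    have h4 := conn_add M (insert x F)
    have h5 := hF.conn_le
    omega
  have hmem : insert x F ∈ T := h.tangle.insert_mem (by omega) hF.mem hxE (by omega)
  have hrank : tangleRank M T θ (insert x F) ≤ 2 :=
    (tangleRank_le_conn hmem Subset.rfl).trans hcx
  have hxZ : x ∉ C ∪ D := fun hxZ ↦ by
    have h1 := h.ncard_le_tangleRank (A := {a, b, x}) (by
      rintro z (rfl | rfl | rfl)
      exacts [Or.inl ha, Or.inr hb, hxZ])
    rw [ncard_eq_three.2 ⟨a, b, x, hab, hxa.symm, hxb.symm, rfl⟩] at h1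
    have h2 := h.tangle.tangleRank_mono (show {a, b, x} ⊆ insert x F by
      rintro z (rfl | rfl | rfl)
      exacts [Or.inr hF.left_mem, Or.inr hF.right_mem, Or.inl rfl])
    omega
  have hwZ : w ∉ C ∪ D := fun hwZ ↦ by
    refine hK.not_indep (h.dual.indep ?_)
    rw [union_comm]
    rintro z (rfl | rfl | rfl)
    exacts [Or.inl ha, Or.inr hb, hwZ]
  -- If `y = w`, the triangle avoids `D` and becomes a parallel pair or a loop in `M ／ C ＼ D`.
  have hyb : y = b := by
    rcases hyK with rfl | rfl | rfl
    · exact absurd rfl hya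
    · rfl
    · exfalso
      have h1 := h.three_le_ncard_circuit_sdiff hJ (by
        rw [Set.disjoint_left, hJeq]
        rintro z (rfl | rfl | rfl) hzD
        exacts [h.disjoint.le_bot ⟨ha, hzD⟩, hwZ (Or.inr hzD), hxZ (Or.inr hzD)])
      have h2 := ncard_le_ncard (show J \ C ⊆ {y, x} by
        rw [hJeq]
        rintro z ⟨rfl | hz, hzC⟩
        exacts [absurd ha hzC, hz]) (by simp)
      have h3 := ncard_pair_le y x
      omega
  subst hyb
  refine ⟨x, hxE, hxF, hxZ, ?_, ?_⟩
  · refine h.exchange ha hb hxZ (J := J) ⟨hJ, hyJ, hxJ, ?_⟩ (Or.inr hF.left_mem)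
      (Or.inr hF.right_mem) (Or.inl rfl) hrank
    rw [hJeq]
    rintro z (rfl | rfl | rfl)
    exacts [Or.inr (Or.inr ha), Or.inl rfl, Or.inr (Or.inl rfl)]
  · refine ⟨Or.inl rfl, Or.inr hF.left_mem, ⟨y, Or.inr hyF, ?_⟩, hmem, ?_, ?_⟩
    · rw [Matroid.dual_dual, insert_comm, pair_comm x y, ← hJeq]
      exact hJ
    · rwa [conn_dual M (insert_subset hxE hFE)]
    · rw [insert_sdiff_self_of_notMem hxF, conn_dual M hFE]
      exact hF.conn_le

end MatroidTangle

/-! ### Systems of fans -/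

namespace MatroidTangle

variable {α ι : Type*} {M N : Matroid α} {C₀ D₀ C' J : Set α} {a b : ι → α} {F : ι → Set α}
  {T : Set (Set α)} {θ : ℕ}

/-- A free minor `M ／ C ＼ D` in which the elements of `C` and `D` outside `C₀` and `D₀` are paired
up by fans. -/
structure IsFanSystem (M N : Matroid α) (T : Set (Set α)) (θ : ℕ) (C₀ D₀ : Set α) (a b : ι → α)
    (F : ι → Set α) : Prop where
  free : IsFreeMinor M N T θ (C₀ ∪ range a) (D₀ ∪ range b)
  left_injective : Function.Injective a
  right_injective : Function.Injective b
  left_notMem : ∀ i, a i ∉ C₀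
  right_notMem : ∀ i, b i ∉ D₀
  fan : ∀ i, IsFanEnd M T (a i) (b i) (F i) ∨ IsFanEnd M✶ T (b i) (a i) (F i)

namespace IsFanSystem

lemma dual [M.Finite] (h : IsFanSystem M N T θ C₀ D₀ a b F) :
    IsFanSystem M✶ N✶ T θ D₀ C₀ b a F :=
  ⟨h.free.dual, h.right_injective, h.left_injective, h.right_notMem, h.left_notMem,
    fun i ↦ by rw [Matroid.dual_dual]; exact (h.fan i).symm⟩

lemma of_dual [M.Finite] (h : IsFanSystem M✶ N✶ T θ D₀ C₀ b a F) :
    IsFanSystem M N T θ C₀ D₀ a b F := by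
  simpa using h.dual

/-- Only `b i` and `F i` change; `C₀` and `D₀` stay fixed, so sets chosen inside them survive all
later exchanges. -/
lemma exists_extension [M.Finite] [Fintype ι] (h : IsFanSystem M N T θ C₀ D₀ a b F) {i : ι}
    (hF : IsFanEnd M T (a i) (b i) (F i)) (hJ : M.IsCircuit J) (hiJ : a i ∈ J)
    (hJ3 : J.ncard = 3) : ∃ (b' : ι → α) (F' : ι → Set α),
      IsFanSystem M N T θ C₀ D₀ a b' F' ∧ ∑ j, (F j).ncard < ∑ j, (F' j).ncard := by
  classical
  obtain ⟨x, hxE, hxF, hxZ, hfree, hend⟩ := h.free.exists_isFanEnd_dual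
    (Or.inr (mem_range_self i)) (Or.inr (mem_range_self i)) hF hJ hiJ hJ3
  have hxb : ∀ j, b j ≠ x := fun j hj ↦ hxZ (Or.inr (Or.inr ⟨j, hj⟩))
  have hD : insert x ((D₀ ∪ range b) \ {b i}) = D₀ ∪ range (Function.update b i x) := by
    ext z
    constructor
    · rintro (rfl | ⟨hz | ⟨j, rfl⟩, hzi⟩)
      · exact Or.inr ⟨i, by simp⟩
      · exact Or.inl hz
      · refine Or.inr ⟨j, Function.update_of_ne ?_ _ _⟩
        rintro rfl
        exact hzi rfl
    · rintro (hz | ⟨j, rfl⟩)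
      · exact Or.inr ⟨Or.inl hz, fun hzi ↦ h.right_notMem i (hzi ▸ hz)⟩
      · by_cases hj : j = i
        · subst hj; exact Or.inl (by simp)
        · rw [Function.update_of_ne hj]
          exact Or.inr ⟨Or.inr ⟨j, rfl⟩, fun hji ↦ hj (h.right_injective hji)⟩
  refine ⟨Function.update b i x, Function.update F i (insert x (F i)),
    ⟨hD ▸ hfree, h.left_injective, ?_, h.left_notMem, fun j ↦ ?_, fun j ↦ ?_⟩, ?_⟩
  · intro j k hjk
    by_cases hj : j = i <;> by_cases hk : k = i
    · rw [hj, hk]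
    · subst hj
      rw [Function.update_self, Function.update_of_ne hk] at hjk
      exact absurd hjk.symm (hxb k)
    · subst hk
      rw [Function.update_self, Function.update_of_ne hj] at hjk
      exact absurd hjk (hxb j)
    · rw [Function.update_of_ne hk, Function.update_of_ne hj] at hjk
      exact h.right_injective hjk
  · by_cases hj : j = i
    · subst hj
      rw [Function.update_self]
      exact fun hx ↦ hxZ (Or.inr (Or.inl hx))
    · rw [Function.update_of_ne hj]
      exact h.right_notMem j
  · by_cases hj : j = i
    · subst hj
      rw [Function.update_self, Function.update_self]
      exact Or.inr hend
    · rw [Function.update_of_ne hj, Function.update_of_ne hj]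
      exact h.fan j
  · have hfin := M.ground_finite.subset (h.free.tangle.subset_ground _ hF.mem)
    refine Finset.sum_lt_sum (fun j _ ↦ ?_) ⟨i, Finset.mem_univ i, ?_⟩
    · by_cases hj : j = i
      · subst hj
        rw [Function.update_self]
        exact ncard_le_ncard (subset_insert _ _) (hfin.insert _)
      · rw [Function.update_of_ne hj]
    · rw [Function.update_self, ncard_insert_of_notMem hxF hfin]
      exact Nat.lt_succ_self _

/-- Moving to the ends of maximal fans. -/
lemma exists_maximal [M.Finite] [Fintype ι] (h : IsFanSystem M N T θ C₀ D₀ a b F) :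
    ∃ (a' b' : ι → α) (F' : ι → Set α), IsFanSystem M N T θ C₀ D₀ a' b' F' ∧ ∀ i,
      (IsFanEnd M T (a' i) (b' i) (F' i) ∧ ∀ J, M.IsCircuit J → a' i ∈ J → J.ncard ≠ 3) ∨
      (IsFanEnd M✶ T (b' i) (a' i) (F' i) ∧ ∀ K, M✶.IsCircuit K → b' i ∈ K → K.ncard ≠ 3) := by
  -- Each extension enlarges a fan, and all fans lie in the ground set, so the total deficit
  -- decreases.
  induction hn : ∑ _j : ι, M.E.ncard - ∑ j, (F j).ncard using Nat.strong_induction_on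
    generalizing a b F with | _ n ih
  by_cases hmax : ∀ i,
      (IsFanEnd M T (a i) (b i) (F i) ∧ ∀ J, M.IsCircuit J → a i ∈ J → J.ncard ≠ 3) ∨
      (IsFanEnd M✶ T (b i) (a i) (F i) ∧ ∀ K, M✶.IsCircuit K → b i ∈ K → K.ncard ≠ 3)
  · exact ⟨a, b, F, h, hmax⟩
  have hstep : ∃ (a' b' : ι → α) (F' : ι → Set α), IsFanSystem M N T θ C₀ D₀ a' b' F' ∧
      ∑ j, (F j).ncard < ∑ j, (F' j).ncard := by
    push Not at hmax
    obtain ⟨i, hi1, hi2⟩ := hmax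
    rcases h.fan i with hF | hF
    · obtain ⟨J, hJ, hiJ, hJ3⟩ := hi1 hF
      obtain ⟨b', F', h', hlt⟩ := h.exists_extension hF hJ hiJ hJ3
      exact ⟨a, b', F', h', hlt⟩
    · obtain ⟨J, hJ, hiJ, hJ3⟩ := hi2 hF
      obtain ⟨a', F', h', hlt⟩ := h.dual.exists_extension hF hJ hiJ hJ3
      exact ⟨a', b, F', h'.of_dual, hlt⟩
  obtain ⟨a', b', F', h', hlt⟩ := hstep
  have hbound : ∑ j, (F' j).ncard ≤ ∑ _j : ι, M.E.ncard := by
    refine Finset.sum_le_sum fun j _ ↦ ncard_le_ncard ?_ M.ground_finite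
    rcases h'.fan j with hF | hF
    · exact h'.free.tangle.subset_ground _ hF.mem
    · exact h'.free.tangle.subset_ground _ hF.mem
  exact ih _ (by omega) h' rfl

/-- Contracting ends of maximal fans together with suitable elements of `C₀`. -/
lemma contract [M.Finite] (h : IsFanSystem M N T θ C₀ D₀ a b F) (hC' : C' ⊆ C₀)
    (hK : ∀ c ∈ C', ∃ f K, IsCircuitVia M✶ D₀ c f K)
    (hJ : ∀ d ∈ D₀, ∀ x J, ¬ IsCircuitVia M C' d x J)
    {S : Set ι} (hS : ∀ i ∈ S, IsFanEnd M T (a i) (b i) (F i) ∧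
      ∀ J, M.IsCircuit J → a i ∈ J → J.ncard ≠ 3) :
    ∃ C'' ⊆ M.E, tangleRank M T θ (N.E ∪ C'') = tangleRank M T θ N.E + C''.ncard ∧
      C''.ncard = C'.ncard + S.ncard ∧ IsKConnected (M ／ C'') 3 ∧ N ≤m M ／ C'' := by
  have hfr := h.free
  set C := C₀ ∪ range a with hC
  set D := D₀ ∪ range b with hD
  have hsub : C' ∪ a '' S ⊆ C := union_subset_union hC' (image_subset_range a S)
  have hCD : ∀ z, z ∈ C → z ∈ D → False := fun z h1 h2 ↦ hfr.disjoint.le_bot ⟨h1, h2⟩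
  have hfin := M.ground_finite.subset hfr.left_subset
  refine ⟨C' ∪ a '' S, hsub.trans hfr.left_subset,
    hfr.tangleRank_union (hsub.trans subset_union_left), ?_, ?_, ?_⟩
  · rw [ncard_union_eq ?_ (hfin.subset (subset_union_left.trans hsub))
      (hfin.subset (subset_union_right.trans hsub)), ncard_image_of_injective _ h.left_injective]
    rw [Set.disjoint_left]
    rintro z hz ⟨i, -, rfl⟩
    exact h.left_notMem i (hC' hz)
  · by_contra hnot
    rw [← Matroid.delete_empty (M ／ (C' ∪ a '' S))] at hnot
    obtain ⟨x, ⟨hxE, hxZ⟩, ⟨d, ⟨hd, -⟩, J, hdJ⟩ | ⟨c, ⟨hc, -⟩, K, hcK⟩⟩ :=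
      hfr.exists_circuitVia_of_not_isKConnected hsub (empty_subset _) hnot
    · have h3 := hfr.three_le_ncard_circuit hdJ.isCircuit
      have hdJ' := hdJ.mono hsub
      -- Orthogonality puts `d` in the cocircuit of `c`, whose part in `D` lies in `D₀`. Likewise
      -- the triad of `a i` below forces `d = b i`, so `J` cannot mix `C'` with fan ends, nor
      -- contain two fan ends.
      have hleft : ∀ c ∈ C', c ∈ J → d ∈ D₀ := by
        intro c hc hcJ
        have hcC : c ∈ C := Or.inl (hC' hc)
        obtain ⟨f, K, hcK⟩ := hK c hc
        have hf : f ∉ C ∪ D := fun hf ↦ by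
          refine hcK.isCircuit.not_indep (hfr.dual.indep ?_)
          rw [union_comm]
          refine hcK.subset.trans (insert_subset (Or.inl hcC) (insert_subset hf ?_))
          exact subset_union_left.trans subset_union_right
        have hdK := hfr.mem_cocircuit_of_mem_circuit hcC hd hf hxZ (hcK.mono subset_union_left)
          hdJ' hcJ
        rcases hcK.subset hdK with rfl | rfl | hdD
        exacts [(hCD _ hcC hd).elim, absurd (Or.inr hd) hf, hdD]
      have hright : ∀ i ∈ S, a i ∈ J → d = b i := by
        intro i hi hiJ
        obtain ⟨w, -, hw⟩ := (hS i hi).1.exists_triad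
        have haC : a i ∈ C := Or.inr (mem_range_self i)
        have hbD : b i ∈ D := Or.inr (mem_range_self i)
        have hwZ : w ∉ C ∪ D := fun hwZ ↦ by
          refine hw.not_indep (hfr.dual.indep ?_)
          rw [union_comm]
          rintro z (rfl | rfl | rfl)
          exacts [Or.inl haC, Or.inr hbD, hwZ]
        have hdK := hfr.mem_cocircuit_of_mem_circuit haC hd hwZ hxZ
          (K := {a i, b i, w}) ⟨hw, by simp, by simp, by
            rintro z (rfl | rfl | rfl)
            exacts [Or.inl rfl, Or.inr (Or.inr hbD), Or.inr (Or.inl rfl)]⟩ hdJ' hiJ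
        rcases hdK with rfl | rfl | rfl
        exacts [(hCD _ haC hd).elim, rfl, absurd (Or.inr hd) hwZ]
      by_cases hd0 : d ∈ D₀
      · refine hJ d hd0 x J ⟨hdJ.isCircuit, hdJ.mem_left, hdJ.mem_right, fun z hz ↦ ?_⟩
        rcases hdJ.subset hz with rfl | rfl | hz' | ⟨i, hi, rfl⟩
        · exact Or.inl rfl
        · exact Or.inr (Or.inl rfl)
        · exact Or.inr (Or.inr hz')
        · exact absurd (hright i hi hz ▸ hd0) (h.right_notMem i)
      · by_cases hex : ∃ i ∈ S, a i ∈ J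
        · obtain ⟨i, hi, hiJ⟩ := hex
          have hJs : J ⊆ {d, x, a i} := by
            intro z hz
            rcases hdJ.subset hz with rfl | rfl | hz' | ⟨j, hj, rfl⟩
            · exact Or.inl rfl
            · exact Or.inr (Or.inl rfl)
            · exact absurd (hleft z hz' hz) hd0
            · have : b i = b j := (hright i hi hiJ).symm.trans (hright j hj hz)
              rw [h.right_injective this]
              exact Or.inr (Or.inr rfl)
          refine (hS i hi).2 J hdJ.isCircuit hiJ (le_antisymm ?_ h3)
          have h4 := ncard_le_ncard hJs (by simp)
          have h5 := ncard_insert_le d {x, a i}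
          have h6 := ncard_pair_le x (a i)
          omega
        · have hJs : J ⊆ {d, x} := by
            intro z hz
            rcases hdJ.subset hz with rfl | rfl | hz' | ⟨j, hj, rfl⟩
            · exact Or.inl rfl
            · exact Or.inr rfl
            · exact absurd (hleft z hz' hz) hd0
            · exact absurd ⟨j, hj, hz⟩ hex
          have h4 := ncard_le_ncard hJs (by simp)
          have h6 := ncard_pair_le d x
          omega
    -- Nothing is deleted, so this would be a cocircuit of `M` with at most two elements.
    · have h3 := hfr.dual.three_le_ncard_circuit hcK.isCircuit
      have h4 := ncard_le_ncard hcK.subset (by simp)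
      rw [insert_empty_eq] at h4
      have h6 := ncard_pair_le c x
      omega
  · refine hfr.isMinor.trans ⟨C \ (C' ∪ a '' S), D, ?_⟩
    rw [Matroid.contract_contract, union_sdiff_cancel hsub]

end IsFanSystem

end MatroidTangle

namespace MatroidTangle

variable {α ι : Type*} {M N : Matroid α} {C D J K : Set α} {c d f g x : α}
  {T : Set (Set α)} {θ : ℕ}

/-! ### Restoring elements -/

namespace IsFreeMinor

variable [M.Finite]

lemma notMem_of_circuitVia (h : IsFreeMinor M N T θ C D) {C₁ : Set α} (hC₁ : C₁ ⊆ C) (hd : d ∈ D)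
    (hJ : IsCircuitVia M C₁ d x J) : x ∉ C ∪ D := fun hx ↦
  hJ.isCircuit.not_indep (h.indep (hJ.subset.trans
    (insert_subset (Or.inr hd) (insert_subset hx (hC₁.trans subset_union_left)))))

lemma exists_mem_left_of_circuitVia (h : IsFreeMinor M N T θ C D) {C₁ : Set α}
    (hJ : IsCircuitVia M C₁ d x J) : ∃ u ∈ J, u ∈ C₁ := by
  by_contra! hno
  have h1 := h.three_le_ncard_circuit hJ.isCircuit
  have h2 := ncard_le_ncard (show J ⊆ {d, x} from fun z hz ↦ by
    rcases hJ.subset hz with rfl | rfl | h3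
    exacts [Or.inl rfl, Or.inr rfl, absurd h3 (hno z hz)]) (by simp)
  have h3 := ncard_pair_le d x
  omega

lemma exists_circuitVia_of_not_restore (h : IsFreeMinor M N T θ C D) (hd : d ∈ D)
    (hnot : ¬ IsKConnected (M ／ C ＼ (D \ {d})) 3) :
    ∃ x J, x ∉ C ∪ D ∧ IsCircuitVia M C d x J := by
  obtain ⟨x, hx, ⟨d', hd', J, hJ⟩ | ⟨c', hc', -⟩⟩ :=
    h.exists_circuitVia_of_not_isKConnected Subset.rfl sdiff_subset hnot
  · rw [sdiff_sdiff_cancel_left (singleton_subset_iff.2 hd)] at hd'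
    obtain rfl : d' = d := hd'
    exact ⟨x, J, hx.2, hJ⟩
  · exact absurd hc'.1 hc'.2

lemma exists_cocircuitVia_of_not_restore (h : IsFreeMinor M N T θ C D) (hc : c ∈ C)
    (hnot : ¬ IsKConnected (M ／ (C \ {c}) ＼ D) 3) :
    ∃ x K, x ∉ C ∪ D ∧ IsCircuitVia M✶ D c x K := by
  obtain ⟨x, hx, ⟨d', hd', -⟩ | ⟨c', hc', K, hK⟩⟩ :=
    h.exists_circuitVia_of_not_isKConnected sdiff_subset Subset.rfl hnot
  · exact absurd hd'.1 hd'.2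
  · rw [sdiff_sdiff_cancel_left (singleton_subset_iff.2 hc)] at hc'
    obtain rfl : c' = c := hc'
    exact ⟨x, K, hx.2, hK⟩

/-- If `c ∉ J`, contracting `C \ {c}` still reduces `J` to a dependent subset of `{d, g}`, so
restoring `c` does not repair the failure. -/
lemma mem_circuit_of_restore (h : IsFreeMinor M N T θ C D) (hd : d ∈ D)
    (hg : g ∉ C ∪ D) (hJ : IsCircuitVia M C d g J)
    (hcon : IsKConnected (M ／ (C \ {c}) ＼ (D \ {d})) 3) : c ∈ J := by
  by_contra hcJ
  have hdC : d ∉ C := fun hdC ↦ h.disjoint.le_bot ⟨hdC, hd⟩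
  have hsub : J \ (C \ {c}) ⊆ {d, g} := by
    rintro z ⟨hz, hzC⟩
    rcases hJ.subset hz with rfl | rfl | h1
    · exact Or.inl rfl
    · exact Or.inr rfl
    · exact absurd ⟨h1, fun hzc ↦ hcJ (hzc ▸ hz)⟩ hzC
  have hdep : (M ／ (C \ {c}) ＼ (D \ {d})).Dep (J \ (C \ {c})) := by
    rw [Matroid.delete_dep_iff]
    refine ⟨hJ.isCircuit.contract_dep_of_not_subset fun hs ↦ hdC (hs hJ.mem_left).1, ?_⟩
    rw [Set.disjoint_left]
    intro z hz hzD
    rcases hsub hz with rfl | rfl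
    exacts [hzD.2 rfl, hg (Or.inr hzD.1)]
  have h4 : 4 ≤ (M ／ (C \ {c}) ＼ (D \ {d})).E.ncard := by
    refine h.four_le_ncard_compl.trans (ncard_le_ncard ?_ (Matroid.ground_finite _))
    rw [minor_ground]
    exact sdiff_subset_sdiff_right (union_subset_union sdiff_subset sdiff_subset)
  have h1 := hcon.three_le_ncard_of_dep h4 hdep
  have h2 := ncard_le_ncard hsub (by simp)
  have h3 := ncard_pair_le d g
  omega

/-- A failure would give a circuit through `d` avoiding `c`, or a cocircuit through `c` avoiding
`d`. By uniqueness these are `J` and `K`, which contain `c` and `d`. -/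
lemma restore_of_mem_cocircuit (h : IsFreeMinor M N T θ C D) (hc : c ∈ C) (hd : d ∈ D)
    (hf : f ∉ C ∪ D) (hg : g ∉ C ∪ D) (hK : IsCircuitVia M✶ D c f K)
    (hJ : IsCircuitVia M C d g J) (hdK : d ∈ K) :
    IsKConnected (M ／ (C \ {c}) ＼ (D \ {d})) 3 := by
  by_contra hnot
  have hcd : c ≠ d := fun hcd ↦ h.disjoint.le_bot ⟨hc, hcd ▸ hd⟩
  obtain ⟨x, hx, ⟨d', hd', L, hL⟩ | ⟨c', hc', L, hL⟩⟩ :=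
    h.exists_circuitVia_of_not_isKConnected sdiff_subset sdiff_subset hnot
  · rw [sdiff_sdiff_cancel_left (singleton_subset_iff.2 hd)] at hd'
    obtain rfl : d' = d := hd'
    have hLJ := h.circuitVia_unique hx.2 hg (hL.mono sdiff_subset) hJ
    have hcL : c ∈ L := hLJ ▸ (h.mem_circuit_iff_mem_cocircuit hc hd hf hg hK hJ).2 hdK
    rcases hL.subset hcL with h1 | rfl | h1
    exacts [hcd h1, hx.2 (Or.inl hc), h1.2 rfl]
  · rw [sdiff_sdiff_cancel_left (singleton_subset_iff.2 hc)] at hc'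
    obtain rfl : c' = c := hc'
    have hLK := h.dual.circuitVia_unique (by rw [union_comm]; exact hx.2)
      (by rwa [union_comm]) (hL.mono sdiff_subset) hK
    rcases hL.subset (hLK ▸ hdK) with h1 | rfl | h1
    exacts [hcd h1.symm, hx.2 (Or.inr hd), h1.2 rfl]

/-- An element of a free minor whose restoration creates only a triad is the end of a fan. -/
lemma isFanEnd (h : IsFreeMinor M N T θ C D) (hc : c ∈ C) (hK : IsCircuitVia M✶ D c f K)
    (hdK : d ∈ K) (hKD : K ∩ D ⊆ {d}) : IsFanEnd M T c d K := by
  have hKs : K ⊆ {c, d, f} := fun z hz ↦ by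
    rcases hK.subset hz with rfl | rfl | h1
    exacts [Or.inl rfl, Or.inr (Or.inr rfl), Or.inr (Or.inl (hKD ⟨hz, h1⟩))]
  have hKE : K ⊆ M.E := hK.isCircuit.subset_ground
  have hcard : K.ncard ≤ 3 := by
    have h1 := ncard_le_ncard hKs (by simp)
    have h2 := ncard_insert_le c {d, f}
    have h3 := ncard_pair_le d f
    omega
  have hθ := h.four_le_order
  have hconn := conn_lt_ncard_of_dep hK.isCircuit.dep
  rw [conn_dual M hKE] at hconn
  refine ⟨hK.mem_left, hdK, ⟨f, hK.mem_right, ?_⟩,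
    h.tangle.mem_of_ncard_lt hKE (by omega), by omega, ?_⟩
  · convert hK.isCircuit using 1
    refine Subset.antisymm ?_ hKs
    rintro z (rfl | rfl | rfl)
    exacts [hK.mem_left, hdK, hK.mem_right]
  · have h1 := conn_le_ncard M (sdiff_subset.trans hKE : K \ {c} ⊆ M.E)
    have h2 := ncard_sdiff_singleton_add_one hK.mem_left (M.ground_finite.subset hKE)
    omega

/-- A large induced matching of elements that create parallel and series pairs when restored
yields a large set whose contraction or deletion keeps the matroid 3-connected. -/
lemma exists_contract_or_delete [Fintype ι] (h : IsFreeMinor M N T θ C D) {c d f g : ι → α}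
    {J K : ι → Set α} (hc : ∀ i, c i ∈ C) (hd : ∀ i, d i ∈ D) (hf : ∀ i, f i ∉ C ∪ D)
    (hg : ∀ i, g i ∉ C ∪ D) (hK : ∀ i, IsCircuitVia M✶ D (c i) (f i) (K i))
    (hJ : ∀ i, IsCircuitVia M C (d i) (g i) (J i)) (hdK : ∀ i j, d j ∈ K i ↔ i = j) {k : ℕ}
    (hk : 2 * k ≤ Fintype.card ι) :
    (∃ C' ⊆ M.E, tangleRank M T θ (N.E ∪ C') = tangleRank M T θ N.E + C'.ncard ∧
      k ≤ C'.ncard ∧ IsKConnected (M ／ C') 3 ∧ N ≤m M ／ C') ∨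
    (∃ D' ⊆ M.E, tangleRank M T θ (N.E ∪ D') = tangleRank M T θ N.E + D'.ncard ∧
      k ≤ D'.ncard ∧ IsKConnected (M ＼ D') 3 ∧ N ≤m M ＼ D') := by
  classical
  have hDfin := M.ground_finite.subset h.right_subset
  have hCD : ∀ z, z ∈ C → z ∈ D → False := fun z h1 h2 ↦ h.disjoint.le_bot ⟨h1, h2⟩
  have hcJ : ∀ i j, c i ∈ J j ↔ i = j := fun i j ↦
    (h.mem_circuit_iff_mem_cocircuit (hc i) (hd j) (hf i) (hg j) (hK i) (hJ j)).trans (hdK i j)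
  have hf' : ∀ i, f i ∉ D ∪ C := fun i ↦ by rw [union_comm]; exact hf i
  have hcinj : Function.Injective c := fun i j hij ↦ by
    rw [← hcJ, hij, hcJ]
  have hdinj : Function.Injective d := fun i j hij ↦ by
    rw [← hdK, ← hij, hdK]
  -- For `i ∈ Y`, the circuit `J i` meets `C` in an unmatched element, so contracting matched
  -- elements alone does not expose it; `X` is the dual notion. For `i ∈ I`, `K i` is a triad and
  -- the pair starts a fan.
  let Y : Set ι := {i | ¬ J i ∩ C ⊆ {c i}}
  let X : Set ι := {i | ¬ K i ∩ D ⊆ {d i}}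
  let I : Set ι := {i | i ∉ Y ∧ i ∉ X}
  -- `P` collects the unmatched elements that would become parallel to something if all of `c '' Y`
  -- were contracted. For each, `φ` picks one element of its circuit to withhold from `C'`, and the
  -- element itself is deleted instead, so the total count does not drop.
  let P : Set α := {u | u ∈ D ∧ u ∉ range d ∧ ∃ x L, x ∉ C ∪ D ∧ IsCircuitVia M C u x L ∧
    L ∩ C ⊆ c '' Y}
  have hφ : ∀ u, ∃ v, u ∈ P → ∃ x L, x ∉ C ∪ D ∧ IsCircuitVia M C u x L ∧ v ∈ L ∧ v ∈ C := by
    intro u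
    by_cases hu : u ∈ P
    · obtain ⟨-, -, x, L, hx, hL, -⟩ := hu
      obtain ⟨v, hvL, hvC⟩ := h.exists_mem_left_of_circuitVia hL
      exact ⟨v, fun _ ↦ ⟨x, L, hx, hL, hvL, hvC⟩⟩
    · exact ⟨u, fun h' ↦ absurd h' hu⟩
  choose φ hφ using hφ
  let C' : Set α := c '' Y \ φ '' P
  let D' : Set α := d '' (X \ Y) ∪ P
  have hC'Y : ∀ i, c i ∈ C' → i ∈ Y := by
    rintro i ⟨⟨j, hj, hij⟩, -⟩
    rwa [← hcinj hij]
  have hC'C : C' ⊆ C := by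
    rintro _ ⟨⟨i, -, rfl⟩, -⟩
    exact hc i
  have hPD : P ⊆ D := fun u hu ↦ hu.1
  have hD'D : D' ⊆ D := by
    rintro _ (⟨i, -, rfl⟩ | hu)
    exacts [hd i, hPD hu]
  let C₀ : Set α := C \ c '' I
  let D₀ : Set α := D \ d '' I
  have hCeq : C₀ ∪ range (fun i : I ↦ c i) = C := by
    rw [← image_eq_range]
    exact sdiff_union_of_subset (by rintro _ ⟨i, -, rfl⟩; exact hc i)
  have hDeq : D₀ ∪ range (fun i : I ↦ d i) = D := by
    rw [← image_eq_range]
    exact sdiff_union_of_subset (by rintro _ ⟨i, -, rfl⟩; exact hd i)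
  have hsys : IsFanSystem M N T θ C₀ D₀ (fun i : I ↦ c i) (fun i : I ↦ d i) (fun i : I ↦ K i) := by
    refine ⟨by rwa [hCeq, hDeq], hcinj.comp Subtype.val_injective,
      hdinj.comp Subtype.val_injective, fun i hi ↦ hi.2 ⟨i, i.2, rfl⟩,
      fun i hi ↦ hi.2 ⟨i, i.2, rfl⟩, fun i ↦ Or.inl ?_⟩
    exact h.isFanEnd (hc i) (hK i) ((hdK i i).2 rfl) (not_not.1 i.2.2)
  obtain ⟨a', b', F', hsys', hmax⟩ := hsys.exists_maximal
  let S : Set I := {i | IsFanEnd M T (a' i) (b' i) (F' i) ∧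
    ∀ J, M.IsCircuit J → a' i ∈ J → J.ncard ≠ 3}
  let S' : Set I := {i | IsFanEnd M✶ T (b' i) (a' i) (F' i) ∧
    ∀ J, M✶.IsCircuit J → b' i ∈ J → J.ncard ≠ 3}
  have hSS' : S ∪ S' = univ := eq_univ_of_forall hmax
  have hcon := hsys'.contract (C' := C') (S := S)
    (by
      rintro _ ⟨⟨i, hi, rfl⟩, -⟩
      refine ⟨hc i, ?_⟩
      rintro ⟨j, hj, hij⟩
      exact hj.1 (hcinj hij ▸ hi))
    (by
      rintro _ ⟨⟨i, hi, rfl⟩, -⟩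
      refine ⟨f i, K i, (hK i).isCircuit, (hK i).mem_left, (hK i).mem_right, fun z hz ↦ ?_⟩
      rcases (hK i).subset hz with h1 | h1 | h1
      · exact Or.inl h1
      · exact Or.inr (Or.inl h1)
      · refine Or.inr (Or.inr ⟨h1, ?_⟩)
        rintro ⟨j, hj, rfl⟩
        exact hj.1 ((hdK i j).1 hz ▸ hi))
    (by
      rintro d₀ ⟨hd₀, -⟩ x L hL
      have hx := h.notMem_of_circuitVia hC'C hd₀ hL
      have hL' := hL.mono hC'C
      have hLC : ∀ u ∈ L, u ∈ C → u ∈ C' := by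
        intro u hu huC
        rcases hL.subset hu with rfl | rfl | h1
        exacts [(hCD _ huC hd₀).elim, absurd (Or.inl huC) hx, h1]
      -- A matched `d j` would need `j ∈ Y`, and then `J j` has an element of `C` other than `c j`,
      -- which would also be some `c i`. An unmatched `d₀` lies in `P`, and `φ d₀` was withheld.
      by_cases hr : d₀ ∈ range d
      · obtain ⟨j, rfl⟩ := hr
        have hLJ := h.circuitVia_unique hx (hg j) hL' (hJ j)
        have hjY : j ∈ Y := hC'Y j (hLC _ (hLJ ▸ (hcJ j j).2 rfl) (hc j))
        obtain ⟨u, hu, huj⟩ := not_subset.1 hjY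
        obtain ⟨⟨i, -, rfl⟩, -⟩ := hLC u (hLJ ▸ hu.1) hu.2
        exact huj (by rw [(hcJ i j).1 hu.1]; rfl)
      · have hP : d₀ ∈ P := ⟨hd₀, hr, x, L, hx, hL', fun u hu ↦ (hLC u hu.1 hu.2).1⟩
        obtain ⟨y, L₀, hy, hL₀, h1, h2⟩ := hφ d₀ hP
        have hLL := h.circuitVia_unique hy hx hL₀ hL'
        exact (hLC _ (hLL ▸ h1) h2).2 ⟨d₀, hP, rfl⟩)
    (fun i hi ↦ hi)
  have hdel := hsys'.dual.contract (C' := D') (S := S')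
    (by
      rintro _ (⟨i, hi, rfl⟩ | hu)
      · refine ⟨hd i, ?_⟩
        rintro ⟨j, hj, hij⟩
        exact hj.2 (hdinj hij ▸ hi.1)
      · refine ⟨hPD hu, ?_⟩
        rintro ⟨j, -, rfl⟩
        exact hu.2.1 ⟨j, rfl⟩)
    (by
      rw [Matroid.dual_dual]
      rintro _ (⟨i, hi, rfl⟩ | hu)
      · refine ⟨g i, J i, (hJ i).isCircuit, (hJ i).mem_left, (hJ i).mem_right, fun z hz ↦ ?_⟩
        rcases (hJ i).subset hz with h1 | h1 | h1
        · exact Or.inl h1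
        · exact Or.inr (Or.inl h1)
        · refine Or.inr (Or.inr ⟨h1, ?_⟩)
          rintro ⟨j, hj, rfl⟩
          exact hj.2 ((hcJ j i).1 hz ▸ hi.1)
      · obtain ⟨-, -, x, L, hx, hL, hLY⟩ := hu
        refine ⟨x, L, hL.isCircuit, hL.mem_left, hL.mem_right, fun z hz ↦ ?_⟩
        rcases hL.subset hz with h1 | h1 | h1
        · exact Or.inl h1
        · exact Or.inr (Or.inl h1)
        · refine Or.inr (Or.inr ⟨h1, ?_⟩)
          rintro ⟨j, hj, rfl⟩
          obtain ⟨i, hi, hij⟩ := hLY ⟨hz, h1⟩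
          exact hj.1 (hcinj hij ▸ hi))
    (by
      rintro c₀ ⟨hc₀, -⟩ x L hL
      have hx := h.dual.notMem_of_circuitVia hD'D hc₀ hL
      have hx' : x ∉ C ∪ D := by rwa [union_comm]
      have hL' := hL.mono hD'D
      have hLD : ∀ u ∈ L, u ∈ D → u ∈ D' := by
        intro u hu huD
        rcases hL.subset hu with rfl | rfl | h1
        exacts [(hCD _ hc₀ huD).elim, absurd (Or.inl huD) hx, h1]
      -- Deleting `P` can only endanger elements of `c '' Y`, because the circuits of its members
      -- meet `C` only there.
      have hLP : ∀ u ∈ P, u ∈ L → c₀ ∈ c '' Y := by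
        rintro u ⟨huD, -, y, L₀, hy, hL₀, hLY⟩ huL
        exact hLY ⟨(h.mem_circuit_iff_mem_cocircuit hc₀ huD hx' hy hL' hL₀).2 huL, hc₀⟩
      by_cases hr : c₀ ∈ range c
      · obtain ⟨j, rfl⟩ := hr
        have hLK := h.dual.circuitVia_unique hx (hf' j) hL' (hK j)
        have hjXY : j ∈ X \ Y := by
          rcases hLD _ (hLK ▸ (hdK j j).2 rfl) (hd j) with ⟨i, hi, hij⟩ | hP
          · rwa [← hdinj hij]
          · exact absurd ⟨j, rfl⟩ hP.2.1
        obtain ⟨u, hu, huj⟩ := not_subset.1 hjXY.1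
        rcases hLD u (hLK ▸ hu.1) hu.2 with ⟨i, -, rfl⟩ | hP
        · exact huj (by rw [(hdK j i).1 hu.1]; rfl)
        · obtain ⟨i, hi, hij⟩ := hLP u hP (hLK ▸ hu.1)
          exact hjXY.2 (hcinj hij ▸ hi)
      · obtain ⟨u, huL, hu⟩ := h.dual.exists_mem_left_of_circuitVia hL
        rcases hu with ⟨i, hi, rfl⟩ | hP
        · have h1 := (h.mem_circuit_iff_mem_cocircuit hc₀ (hd i) hx' (hg i) hL' (hJ i)).2 huL
          have h2 : c₀ = c i := not_not.1 hi.2 ⟨h1, hc₀⟩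
          exact hr ⟨i, h2.symm⟩
        · obtain ⟨i, -, hi⟩ := hLP u hP huL
          exact hr ⟨i, hi⟩)
    (fun i hi ↦ hi)
  obtain ⟨C'', hC''E, hC''r, hC''c, hC''k, hC''m⟩ := hcon
  obtain ⟨D'', hD''E, hD''r, hD''c, hD''k, hD''m⟩ := hdel
  have hPfin := hDfin.subset hPD
  -- `|C'| ≥ |Y| - |P|` and `|D'| = |X \ Y| + |P|`, while every fan contributes to at least one
  -- side.
  have hcount : Fintype.card ι ≤ C''.ncard + D''.ncard := by
    have h1 : Y.ncard ≤ C'.ncard + P.ncard := by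
      have h11 := le_ncard_sdiff (φ '' P) (c '' Y) (hPfin.image φ)
      rw [ncard_image_of_injective _ hcinj] at h11
      have h12 := ncard_image_le (f := φ) hPfin
      have h13 : (c '' Y \ φ '' P).ncard = C'.ncard := rfl
      omega
    have h2 : D'.ncard = (X \ Y).ncard + P.ncard := by
      rw [ncard_union_eq ?_ (toFinite _) hPfin, ncard_image_of_injective _ hdinj]
      rw [Set.disjoint_left]
      rintro _ ⟨i, -, rfl⟩ hP
      exact hP.2.1 ⟨i, rfl⟩
    have h3 := ncard_union_le S S'
    rw [hSS', ncard_univ, Nat.card_coe_set_eq] at h3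
    have h4 : Fintype.card ι ≤ Y.ncard + (X \ Y).ncard + I.ncard := by
      have h41 : (univ : Set ι) ⊆ Y ∪ X \ Y ∪ I := fun i _ ↦ by
        by_cases hY : i ∈ Y
        · exact Or.inl (Or.inl hY)
        · by_cases hX : i ∈ X
          · exact Or.inl (Or.inr ⟨hX, hY⟩)
          · exact Or.inr ⟨hY, hX⟩
      have h42 := ncard_le_ncard h41 (toFinite _)
      rw [ncard_univ, Nat.card_eq_fintype_card] at h42
      have h43 := ncard_union_le (Y ∪ X \ Y) I
      have h44 := ncard_union_le Y (X \ Y)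
      omega
    omega
  by_cases hkC : k ≤ C''.ncard
  · exact Or.inl ⟨C'', hC''E, hC''r, hkC, hC''k, hC''m⟩
  · refine Or.inr ⟨D'', hD''E, ?_, by omega, ?_, ?_⟩
    · rw [h.tangle.tangleRank_dual, h.tangle.tangleRank_dual] at hD''r
      exact hD''r
    · rw [← Matroid.dual_delete] at hD''k
      exact isKConnected_dual_iff.1 hD''k
    · have := isMinor_dual hD''m
      simpa using this

end IsFreeMinor

end MatroidTangle

/-! ### From the restoration graph to circuits and cocircuits -/

open MatroidTangle in
theorem mainTheorem7 {α : Type*} (k : ℤ) (M N : Matroid α) [M.Finite]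
    (hM : IsKConnected M 3)
    (T : Set (Set α)) (θ : ℕ) (hT : IsTangle M T θ)
    (C D : Set α) (hC : C ⊆ M.E) (hD : D ⊆ M.E) (hCD : Disjoint C D)
    (hMCD : IsKConnected (M ／ C ＼ D) 3)
    (hN : N ≤m M ／ C ＼ D)
    (hrank : tangleRank M T θ (N.E ∪ C ∪ D) = tangleRank M T θ N.E + (C ∪ D).ncard)
    (H : (restorationGraph M C D hCD).Subgraph)
    (hind : H.IsInduced) (hmatch : H.IsMatching)
    (hcard : 2 * k ≤ (H.edgeSet.ncard : ℤ))
    (hpriv : ∀ v ∈ H.verts, ¬ IsPrivileged M C D v) :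
    (∃ C' ⊆ M.E, tangleRank M T θ (N.E ∪ C') = tangleRank M T θ N.E + C'.ncard ∧
      k ≤ (C'.ncard : ℤ) ∧ IsKConnected (M ／ C') 3 ∧ N ≤m M ／ C') ∨
    (∃ D' ⊆ M.E, tangleRank M T θ (N.E ∪ D') = tangleRank M T θ N.E + D'.ncard ∧
      k ≤ (D'.ncard : ℤ) ∧ IsKConnected (M ＼ D') 3 ∧ N ≤m M ＼ D') := by
  classical
  -- For `k ≤ 0` the empty set serves. For `k > 0` there are at least two matching edges, whence `|C
  -- ∪ D| ≥ 4`.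
  obtain hk | hk := le_or_gt k 0
  · refine Or.inl ⟨∅, empty_subset _, by simp, by simpa using hk, by simpa using hM, ?_⟩
    rw [Matroid.contract_empty]
    exact hN.trans ⟨C, D, rfl⟩
  have hCfin := M.ground_finite.subset hC
  have hDfin := M.ground_finite.subset hD
  have : Finite ↥(C ∪ D) := (hCfin.union hDfin).to_subtype
  have hdis : ∀ z, z ∈ C → z ∈ D → False := fun z h1 h2 ↦ hCD.le_bot ⟨h1, h2⟩
  let ι := {v : ↥(C ∪ D) // v ∈ H.verts ∧ (v : α) ∈ C}
  have : Fintype ι := Fintype.ofFinite ι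
  choose p hp hpu using fun i : ι ↦ hmatch i.2.1
  have hedge : ∀ {v w : ↥(C ∪ D)}, (restorationGraph M C D hCD).Adj v w → (v : α) ∈ C →
      RestorationEdge M C D v w := by
    rintro v w (h | h) hv
    · exact h
    · exact (hdis _ hv h.2.1).elim
  have hpe : ∀ i : ι, RestorationEdge M C D i.1 (p i) := fun i ↦ hedge (hp i).adj_sub i.2.2
  have hpinj : Function.Injective p := fun i j hij ↦
    Subtype.ext (hmatch.eq_of_adj_right (hp i) (hij ▸ hp j))
  have hedges : H.edgeSet.ncard ≤ Fintype.card ι := by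
    have hsub : H.edgeSet ⊆ range (fun i : ι ↦ s(i.1, p i)) := by
      intro e
      induction e using Sym2.ind with | _ v w
      intro he
      rw [SimpleGraph.Subgraph.mem_edgeSet] at he
      rcases he.adj_sub with h | h
      · exact ⟨⟨v, he.fst_mem, h.1⟩, congrArg (fun u ↦ s(v, u)) (hpu ⟨v, he.fst_mem, h.1⟩ w he).symm⟩
      · exact ⟨⟨w, he.snd_mem, h.1⟩, (congrArg (fun u ↦ s(w, u))
          (hpu ⟨w, he.snd_mem, h.1⟩ v he.symm).symm).trans Sym2.eq_swap⟩
    refine (ncard_le_ncard hsub (toFinite _)).trans ?_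
    rw [← image_univ]
    exact (ncard_image_le (toFinite _)).trans (by rw [ncard_univ, Nat.card_eq_fintype_card])
  have hcinj : Function.Injective (fun i : ι ↦ (i.1 : α)) :=
    Subtype.val_injective.comp Subtype.val_injective
  have hdinj : Function.Injective (fun i : ι ↦ (p i : α)) := Subtype.val_injective.comp hpinj
  have hfour : 4 ≤ (C ∪ D).ncard := by
    have h1 := ncard_le_ncard (show range (fun i : ι ↦ (i.1 : α)) ⊆ C by
      rintro _ ⟨i, rfl⟩; exact i.2.2) hCfin
    have h2 := ncard_le_ncard (show range (fun i : ι ↦ (p i : α)) ⊆ D by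
      rintro _ ⟨i, rfl⟩; exact (hpe i).2.1) hDfin
    rw [← image_univ, ncard_image_of_injective _ hcinj, ncard_univ,
      Nat.card_eq_fintype_card] at h1
    rw [← image_univ, ncard_image_of_injective _ hdinj, ncard_univ,
      Nat.card_eq_fintype_card] at h2
    rw [ncard_union_eq hCD hCfin hDfin]
    omega
  have h : IsFreeMinor M N T θ C D := ⟨hM, hT, hC, hD, hCD, hMCD, hN, hrank, hfour⟩
  have hK : ∀ i : ι, ∃ x K, x ∉ C ∪ D ∧ IsCircuitVia M✶ D i.1 x K := fun i ↦ by
    refine h.exists_cocircuitVia_of_not_restore i.2.2 ?_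
    have := hpriv _ i.2.1
    rwa [IsPrivileged, restore, sdiff_singleton_eq_self (hdis _ i.2.2)] at this
  have hJ : ∀ i : ι, ∃ x J, x ∉ C ∪ D ∧ IsCircuitVia M C (p i) x J := fun i ↦ by
    refine h.exists_circuitVia_of_not_restore (hpe i).2.1 ?_
    have := hpriv _ (hp i).snd_mem
    rwa [IsPrivileged, restore, sdiff_singleton_eq_self fun hc ↦ hdis _ hc (hpe i).2.1] at this
  choose f K hf hK using hK
  choose g J hg hJ using hJ
  -- Membership in `K i` is adjacency; inducedness puts the edge in `H`, and the matching property
  -- then identifies `i` with `j`.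
  have hdK : ∀ i j : ι, (p j : α) ∈ K i ↔ i = j := by
    intro i j
    constructor
    · intro hj
      have hcon := h.restore_of_mem_cocircuit i.2.2 (hpe j).2.1 (hf i) (hg j) (hK i) (hJ j) hj
      have hadj : (restorationGraph M C D hCD).Adj i.1 (p j) :=
        Or.inl ⟨i.2.2, (hpe j).2.1, hcon⟩
      exact Subtype.ext (hmatch.eq_of_adj_right (hind i.2.1 (hp j).snd_mem hadj) (hp j))
    · rintro rfl
      have h1 := h.mem_circuit_of_restore (hpe i).2.1 (hg i) (hJ i) (hpe i).2.2
      exact (h.mem_circuit_iff_mem_cocircuit i.2.2 (hpe i).2.1 (hf i) (hg i) (hK i) (hJ i)).1 h1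
  obtain ⟨n, rfl⟩ := Int.eq_ofNat_of_zero_le hk.le
  have key := h.exists_contract_or_delete (k := n) (fun i : ι ↦ i.2.2) (fun i ↦ (hpe i).2.1) hf hg
    hK hJ hdK (by omega)
  exact_mod_cast key
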